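/- Let $b>0$ and $s>0$. For $a\ge b$ let $\Omega=\{x^2/a^2+y^2/b^2<1\}\subset\mathbb R^2$ be the elliptic domain with semiaxes $a,b$ and eccentricity $\varepsilon=\sqrt{1-(b/a)^2}\in[0,1)$. Let $$H(t)=\frac1{|\Omega|}\int_\Omega (e^{t\Delta}1)(\mathbf r)\,d\mathbf r$$ be its normalized heat content, where $e^{t\Delta}$ is the heat semigroup of the Dirichlet Laplacian on $L^2(\Omega)$, and let $\tilde H(s)=\int_0^\infty e^{-s^2t}H(t)\,dt$ be its Laplace transform. Let $D$ be the disk of radius $b$ centred at the origin. There is exactly one sequence of functions $h_n\in H^1_0(D)$, $n\ge 0$, solving (weakly, with Dirichlet boundary condition) $$\Delta h_0-s^2h_0=-1,\qquad \Delta h_{n+1}-s^2h_{n+1}=\frac{\partial^2h_n}{\partial x^2}\quad(n\ge0).$$ Their means $\tilde H_j^{(0)}(s)=\frac1{\pi b^2}\int_D h_j\,d\mathbf r$ are real numbers, which depend only on $s$ and $b$, and for every $a\ge b$ the integral defining $\tilde H(s)$ converges absolutely and $$\tilde H(s)=\sum_{j=0}^\infty \tilde H_j^{(0)}(s)\,\varepsilon^{2j}$$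 with a convergent series. Moreover, with $u=sb$ and $I_k=I_k(u)$ the modified Bessel functions of the first kind, $$\tilde H_0^{(0)}=\frac1{s^2}\Bigl[1-\frac{2I_1}{uI_0}\Bigr],\qquad \tilde H_1^{(0)}=-\frac1{2s^2}\Bigl[1-\frac{2I_1}{uI_0}-\frac{I_1^2}{I_0^2}\Bigr],$$ $$\tilde H_2^{(0)}=\frac{1}{16s^2u^3I_0^3I_2^2}\Bigl[-2u^3I_0^5+3u^2(4+u^2)I_0^4I_1-u(24+11u^2)I_0^3I_1^2+(16+8u^2-3u^4)I_0^2I_1^3+2u(2+5u^2)I_0I_1^4-8u^2I_1^5\Bigr],$$ $$\tilde H_3^{(0)}=\frac{1}{192s^2u^3I_0^4I_2^2}\Bigl[u^3(-12+5u^2)I_0^6+2u^2(36+7u^2)I_0^5I_1-2u(72+57u^2+10u^4)I_0^4I_1^2+32(3+4u^2+u^4)I_0^3I_1^3+u(8+52u^2+15u^4)I_0^2I_1^4-36u^2(2+u^2)I_0I_1^5+24u^3I_1^6\Bigr].$$ -/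

import Mathlib

open MeasureTheory Set
open scoped ContDiff InnerProductSpace Nat

noncomputable section

namespace HeatContent

/-- The modified Bessel function of the first kind of integer order `n`,
`I_n(x) = ∑ₖ (x/2)^(2k+n) / (k! (k+n)!)`. -/
def besselI (n : ℕ) (x : ℝ) : ℝ :=
  ∑' k : ℕ, (x / 2) ^ (2 * k + n) / ((k ! : ℝ) * ((k + n)! : ℝ))

/-- The (open) elliptic domain `x²/a² + y²/b² < 1`. -/
def ellipse (a b : ℝ) : Set (ℝ × ℝ) :=
  {p | p.1 ^ 2 / a ^ 2 + p.2 ^ 2 / b ^ 2 < 1}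

/-- The (open) disk of radius `b` centred at the origin. -/
def disk (b : ℝ) : Set (ℝ × ℝ) :=
  {p | p.1 ^ 2 + p.2 ^ 2 < b ^ 2}

/-- The complex Hilbert space `L²(Ω)` (Lebesgue measure of the plane, restricted to `Ω`). -/
abbrev L2 (Ω : Set (ℝ × ℝ)) : Type :=
  Lp ℂ 2 ((volume : Measure (ℝ × ℝ)).restrict Ω)

/-- Triples of elements of `L²(Ω)`, with the Hilbert space structure of the direct sum. -/
abbrev Jet (Ω : Set (ℝ × ℝ)) : Type :=
  PiLp 2 (fun _ : Fin 3 => L2 Ω)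

/-- A test function on `Ω`: smooth, with compact support contained in `Ω`. -/
def IsTestFunction (Ω : Set (ℝ × ℝ)) (f : ℝ × ℝ → ℂ) : Prop :=
  ContDiff ℝ ∞ f ∧ HasCompactSupport f ∧ tsupport f ⊆ Ω

/-- The triple `w` is `(f, ∂f/∂x, ∂f/∂y)`. -/
def IsJetOf (Ω : Set (ℝ × ℝ)) (w : Jet Ω) (f : ℝ × ℝ → ℂ) : Prop :=
  (w 0 =ᵐ[volume.restrict Ω] f) ∧
  (w 1 =ᵐ[volume.restrict Ω] fun p => fderiv ℝ f p (1, 0)) ∧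
  (w 2 =ᵐ[volume.restrict Ω] fun p => fderiv ℝ f p (0, 1))

/-- The Sobolev space `H¹₀(Ω)`: the closure of the test functions in the norm
`(‖f‖² + ‖∂f/∂x‖² + ‖∂f/∂y‖²)^(1/2)`. An element `w` is stored together with its weak gradient:
`w 0` is the function itself, `w 1` and `w 2` are its weak partial derivatives in `x` and `y`. -/
def H10 (Ω : Set (ℝ × ℝ)) : Submodule ℂ (Jet Ω) :=
  (Submodule.span ℂ {w : Jet Ω | ∃ f, IsTestFunction Ω f ∧ IsJetOf Ω w f}).topologicalClosure

instance (Ω : Set (ℝ × ℝ)) : CompleteSpace (H10 Ω) :=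
  (Submodule.isClosed_topologicalClosure _).completeSpace_coe

/-- The inclusion `H¹₀(Ω) → L²(Ω)`. -/
def H10.toL2 (Ω : Set (ℝ × ℝ)) : H10 Ω →L[ℂ] L2 Ω :=
  (PiLp.proj 2 (fun _ : Fin 3 => L2 Ω) 0).comp (H10 Ω).subtypeL

/-- The resolvent `(1 - Δ)⁻¹` on `L²(Ω)` of the Dirichlet Laplacian `Δ` of `Ω`. With `J` the
inclusion of `H¹₀(Ω)` in `L²(Ω)`, `u = J† f` is the element of `H¹₀(Ω)` such that
`⟪∇u, ∇v⟫ + ⟪u, v⟫ = ⟪f, v⟫` for all `v ∈ H¹₀(Ω)`, that is, the weak solution of `u - Δu = f`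
with Dirichlet boundary condition; so the resolvent is `J J†`. -/
def dirichletResolvent (Ω : Set (ℝ × ℝ)) : L2 Ω →L[ℂ] L2 Ω :=
  (H10.toL2 Ω).comp (ContinuousLinearMap.adjoint (H10.toL2 Ω))

/-- For a self-adjoint operator `T = (1 + A)⁻¹` on a Hilbert space, where `A ≥ 0` is self-adjoint
(and in general unbounded), so that the spectrum of `T` lies in `[0, 1]`: the operator `exp(-tA)`,
`t > 0`, obtained from `T` through the functional calculus. A spectral value `μ` of `A` corresponds
to `x = 1/(1+μ)` of `T`, so `exp(-tμ) = exp(-t(1/x - 1))`, which tends to `0` as `x → 0+`. -/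
def expOfResolvent {H : Type*} [NormedAddCommGroup H] [InnerProductSpace ℂ H] [CompleteSpace H]
    (T : H →L[ℂ] H) (t : ℝ) : H →L[ℂ] H :=
  cfc (fun x : ℝ => if x = 0 then 0 else Real.exp (-t * (1 / x - 1))) T

/-- The Dirichlet heat semigroup `exp(tΔ)`, `t > 0`, on `L²(Ω)`, which solves `∂ρ/∂t = Δρ` with
Dirichlet boundary condition. -/
def heatSemigroup (Ω : Set (ℝ × ℝ)) (t : ℝ) : L2 Ω →L[ℂ] L2 Ω :=
  expOfResolvent (dirichletResolvent Ω) t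

open Classical in
/-- The constant function `1` as an element of `L²(Ω)`, for `Ω` of finite area. -/
def one (Ω : Set (ℝ × ℝ)) : L2 Ω :=
  if h : MemLp (fun _ : ℝ × ℝ => (1 : ℂ)) 2 (volume.restrict Ω) then h.toLp else 0

/-- The mean value `|Ω|⁻¹ ∫_Ω u`. -/
def mean (Ω : Set (ℝ × ℝ)) (u : L2 Ω) : ℂ :=
  (((volume Ω).toReal⁻¹ : ℝ) : ℂ) * ∫ p in Ω, u p

/-- The local heat content `H(t; ·) = ∫_Ω ρ(r, t | ·, 0) dr = exp(tΔ) 1`. -/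
def localHeatContent (Ω : Set (ℝ × ℝ)) (t : ℝ) : L2 Ω :=
  heatSemigroup Ω t (one Ω)

/-- The normalized heat content `H(t)`, the mean of the local heat content over `Ω`. -/
def heatContent (Ω : Set (ℝ × ℝ)) (t : ℝ) : ℝ :=
  (mean Ω (localHeatContent Ω t)).re

/-- The Laplace transform `∫₀^∞ exp(-s² t) H(t) dt` of the heat content. -/
def heatContentLaplace (Ω : Set (ℝ × ℝ)) (s : ℝ) : ℝ :=
  ∫ t in Ioi (0 : ℝ), Real.exp (-s ^ 2 * t) * heatContent Ω t

/-- The sequence of local coefficients of the expansion in `λ = ε²` on the disk of radius `b`: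
`h n ∈ H¹₀` is the weak solution, with Dirichlet boundary condition, of
`Δ h₀ - s² h₀ = -1` and `Δ hₙ₊₁ - s² hₙ₊₁ = ∂²hₙ/∂x²`. -/
def IsLocalExpansion (b s : ℝ) (h : ℕ → H10 (disk b)) : Prop :=
  (∀ v : H10 (disk b),
    ⟪v.1 1, (h 0).1 1⟫_ℂ + ⟪v.1 2, (h 0).1 2⟫_ℂ + (s : ℂ) ^ 2 * ⟪v.1 0, (h 0).1 0⟫_ℂ
      = ⟪v.1 0, one (disk b)⟫_ℂ) ∧
  (∀ (n : ℕ) (v : H10 (disk b)),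
    ⟪v.1 1, (h (n + 1)).1 1⟫_ℂ + ⟪v.1 2, (h (n + 1)).1 2⟫_ℂ
        + (s : ℂ) ^ 2 * ⟪v.1 0, (h (n + 1)).1 0⟫_ℂ
      = ⟪v.1 1, (h n).1 1⟫_ℂ)

end HeatContent

end

/-! The stretch `x ↦ (b/a) x` turns the ellipse into the disk and the resolvent equation at `s²`
into `s² w - (1 - λ) ∂ₓ²w - ∂ᵧ²w = 1` with `λ = ε²`. Through the functional calculus the Laplace
transform of the semigroup is this resolvent (`laplace_expOfResolvent`, `heatContentLaplace_eq`), so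
the transformed heat content is the mean of `w` over the disk (`heatContentLaplace_ellipse`).

Let `⟪·,·⟫ₛ` be the energy form of `s² - Δ`. By Lax–Milgram the recursion reads `h (n+1) = K (h n)`,
where `K` represents `⟪∂ₓv, ∂ₓg⟫` in that form. `K` is symmetric and `0 ≤ K ≤ 1`, so energies do not
increase (`IsLocalExpansion.exists_bound`) and `w = ∑ λⁿ h n` converges for `0 ≤ λ < 1`.

Symmetry also gives `⟪1, h (i+j)⟫ = ⟪h i, h j⟫ₛ`. Thus `h 0` and `h 1` alone determine the first
four means: those of `h 1`, `h 2`, `h 3` are, up to the area, the `L²` pairings of `∂ₓ(h 0)` and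
`∂ₓ(h 1)`. Both functions are found explicitly in terms of `E_n(κ r²)` with `κ = s²/4`. These are
smooth at the origin, unlike expressions in `r = √(x² + y²)`. In the variable `t = κ r²` the radial
integrals have primitives polynomial in `t`, `E₁`, `E₂`. -/

namespace HeatContent

/-! ### Bessel series: derivative and recurrence -/

/-- The entire function `E_n(t) = ∑ₖ t^k / (k! (k+n)!)`, so that `I_n(x) = (x/2)^n E_n(x²/4)`. -/
noncomputable def besselE (n : ℕ) (t : ℝ) : ℝ :=
  ∑' k : ℕ, t ^ k / ((k ! : ℝ) * ((k + n)! : ℝ))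

lemma norm_besselE_term_le (n k : ℕ) (t : ℝ) :
    ‖t ^ k / ((k ! : ℝ) * ((k + n)! : ℝ))‖ ≤ |t| ^ k / (k ! : ℝ) := by
  rw [norm_div, norm_pow, Real.norm_eq_abs, Real.norm_of_nonneg (by positivity)]
  have h1 : (1 : ℝ) ≤ ((k + n)! : ℝ) := by exact_mod_cast Nat.one_le_of_lt (Nat.factorial_pos _)
  gcongr
  exact le_mul_of_one_le_right (by positivity) h1

lemma summable_besselE (n : ℕ) (t : ℝ) :
    Summable fun k : ℕ => t ^ k / ((k ! : ℝ) * ((k + n)! : ℝ)) :=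
  Summable.of_norm_bounded (Real.summable_pow_div_factorial |t|)
    fun k => norm_besselE_term_le n k t

lemma besselI_eq (n : ℕ) (x : ℝ) : besselI n x = (x / 2) ^ n * besselE n (x ^ 2 / 4) := by
  rw [besselI, besselE, ← tsum_mul_left]
  congr 1
  ext k
  rw [pow_add, pow_mul, show x ^ 2 / 4 = (x / 2) ^ 2 by ring]
  ring

lemma besselE_pos (n : ℕ) {t : ℝ} (ht : 0 ≤ t) : 0 < besselE n t :=
  (summable_besselE n t).tsum_pos (fun k => by positivity) 0 (by positivity)

/-- Termwise differentiation of the series lowers the power and shifts the index. The family is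
therefore closed under derivatives, with no factors `1/t`. -/
lemma hasDerivAt_besselE (n : ℕ) (t : ℝ) : HasDerivAt (besselE n) (besselE (n + 1) t) t := by
  have hshift : besselE (n + 1) t
      = ∑' k : ℕ, (k : ℝ) * t ^ (k - 1) / ((k ! : ℝ) * ((k + n)! : ℝ)) := by
    have hterm : ∀ k : ℕ, ((k + 1 : ℕ) : ℝ) * t ^ (k + 1 - 1) / (((k + 1)! : ℝ) *
        ((k + 1 + n)! : ℝ)) = t ^ k / ((k ! : ℝ) * ((k + (n + 1))! : ℝ)) := by
      intro k
      rw [Nat.factorial_succ k, show k + 1 + n = k + (n + 1) by ring, Nat.add_sub_cancel]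
      push_cast
      field_simp
    have hs := (summable_nat_add_iff (f := fun k : ℕ => (k : ℝ) * t ^ (k - 1) /
      ((k ! : ℝ) * ((k + n)! : ℝ))) 1).1 ((summable_besselE (n + 1) t).congr fun k => (hterm k).symm)
    rw [besselE, hs.tsum_eq_zero_add]
    simp only [hterm]
    simp
  rw [hshift]
  -- On the ball of radius `|t| + 1` the differentiated terms are dominated by the derivative terms
  -- of an exponential series.
  refine hasDerivAt_tsum_of_isPreconnected (u := fun k : ℕ => (k : ℝ) * (|t| + 1) ^ (k - 1) / (k ! : ℝ))
    (t := Metric.ball 0 (|t| + 1)) (y₀ := 0) ?_ Metric.isOpen_ball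
    (convex_ball _ _).isPreconnected (g := fun k y => y ^ k / ((k ! : ℝ) * ((k + n)! : ℝ)))
    (g' := fun k y => (k : ℝ) * y ^ (k - 1) / ((k ! : ℝ) * ((k + n)! : ℝ))) ?_ ?_ ?_ ?_ ?_
  · rw [← summable_nat_add_iff 1]
    refine (Real.summable_pow_div_factorial (|t| + 1)).congr fun k => ?_
    rw [Nat.factorial_succ k, Nat.add_sub_cancel]
    push_cast
    field_simp
  · intro k y _
    exact (hasDerivAt_pow k y).div_const _
  · intro k y hy
    have hy' : |y| ≤ |t| + 1 := by simpa using (mem_ball_zero_iff.1 hy).le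
    have h1 : (1 : ℝ) ≤ ((k + n)! : ℝ) := by exact_mod_cast Nat.one_le_of_lt (Nat.factorial_pos _)
    rw [norm_div, norm_mul, norm_pow, Real.norm_eq_abs y, Real.norm_of_nonneg (by positivity),
      Real.norm_of_nonneg (by positivity)]
    gcongr
    exact le_mul_of_one_le_right (by positivity) h1
  · simp; positivity
  · exact summable_besselE n 0
  · simp

lemma contDiff_besselE (n : ℕ) : ContDiff ℝ ∞ (besselE n) := by
  rw [contDiff_infty]
  intro m
  induction m generalizing n with
  | zero =>
    exact contDiff_zero.2
      (continuous_iff_continuousAt.2 fun t => (hasDerivAt_besselE n t).continuousAt)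
  | succ m ih =>
    rw [show ((m + 1 : ℕ) : WithTop ℕ∞) = (m : WithTop ℕ∞) + 1 by norm_cast,
      contDiff_succ_iff_deriv]
    refine ⟨fun t => (hasDerivAt_besselE n t).differentiableAt, by simp, ?_⟩
    rw [show deriv (besselE n) = besselE (n + 1) from funext fun t => (hasDerivAt_besselE n t).deriv]
    exact ih (n + 1)

/-- Coefficientwise this is `1/(k! (k+n)!) = ((n+1) + k)/(k! (k+n+1)!)`. It plays the role of
Bessel's equation below. -/
lemma besselE_recurrence (n : ℕ) (t : ℝ) :
    besselE n t = (n + 1) * besselE (n + 1) t + t * besselE (n + 2) t := by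
  have h2 : t * besselE (n + 2) t
      = ∑' k : ℕ, (k : ℝ) * t ^ k / ((k ! : ℝ) * ((k + (n + 1))! : ℝ)) := by
    have hterm : ∀ k : ℕ, ((k + 1 : ℕ) : ℝ) * t ^ (k + 1) / (((k + 1)! : ℝ) *
        ((k + 1 + (n + 1))! : ℝ)) = t * (t ^ k / ((k ! : ℝ) * ((k + (n + 2))! : ℝ))) := by
      intro k
      rw [Nat.factorial_succ k, show k + 1 + (n + 1) = k + (n + 2) by ring]
      push_cast
      field_simp
      ring
    have hs := (summable_nat_add_iff (f := fun k : ℕ => (k : ℝ) * t ^ k /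
      ((k ! : ℝ) * ((k + (n + 1))! : ℝ))) 1).1
      (((summable_besselE (n + 2) t).mul_left t).congr fun k => (hterm k).symm)
    rw [besselE, hs.tsum_eq_zero_add, ← tsum_mul_left]
    simp only [hterm]
    simp
  have hs : Summable fun k : ℕ => (k : ℝ) * t ^ k / ((k ! : ℝ) * ((k + (n + 1))! : ℝ)) := by
    refine ((summable_besselE n t).sub ((summable_besselE (n + 1) t).mul_left ((n : ℝ) + 1))).congr
      fun k => ?_
    rw [← add_assoc k n 1, Nat.factorial_succ (k + n)]
    push_cast
    field_simp
    ring
  rw [h2, besselE, besselE, ← tsum_mul_left, ← ((summable_besselE (n + 1) t).mul_left _).tsum_add hs]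
  congr 1
  ext k
  rw [← add_assoc k n 1, Nat.factorial_succ (k + n)]
  push_cast
  field_simp
  ring

end HeatContent

/-! ### The Helmholtz form and the perturbation series on the disk -/

namespace HeatContent

variable {Ω : Set (ℝ × ℝ)}

/-- The component `i` (function, `x`-derivative, `y`-derivative) of an element of `H¹₀(Ω)`. -/
noncomputable def H10.comp (Ω : Set (ℝ × ℝ)) (i : Fin 3) : H10 Ω →L[ℂ] L2 Ω :=
  (PiLp.proj 2 (fun _ : Fin 3 => L2 Ω) i).comp (H10 Ω).subtypeL

@[simp] lemma H10.comp_apply (i : Fin 3) (v : H10 Ω) : H10.comp Ω i v = v.1 i := rfl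

@[simp] lemma H10.toL2_apply (v : H10 Ω) : H10.toL2 Ω v = v.1 0 := rfl

lemma H10.inner_eq (v w : H10 Ω) :
    ⟪v, w⟫_ℂ = ⟪v.1 0, w.1 0⟫_ℂ + ⟪v.1 1, w.1 1⟫_ℂ + ⟪v.1 2, w.1 2⟫_ℂ := by
  rw [Submodule.coe_inner, PiLp.inner_apply, Fin.sum_univ_three]

lemma H10.norm_sq_eq (v : H10 Ω) :
    ‖v‖ ^ 2 = ‖v.1 0‖ ^ 2 + ‖v.1 1‖ ^ 2 + ‖v.1 2‖ ^ 2 := by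
  rw [Submodule.coe_norm, PiLp.norm_sq_eq_of_L2, Fin.sum_univ_three]

/-- The form `⟪∇v, ∇h⟫ + s² ⟪v, h⟫` of the operator `s² - Δ` with Dirichlet condition. -/
noncomputable def helmholtzForm (s : ℝ) (v h : H10 Ω) : ℂ :=
  ⟪v.1 1, h.1 1⟫_ℂ + ⟪v.1 2, h.1 2⟫_ℂ + (s : ℂ) ^ 2 * ⟪v.1 0, h.1 0⟫_ℂ

/-- The bounded operator on `H¹₀(Ω)` that represents `helmholtzForm`. -/
noncomputable def helmholtzOp (Ω : Set (ℝ × ℝ)) (s : ℝ) : H10 Ω →L[ℂ] H10 Ω :=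
  (H10.comp Ω 1).adjoint.comp (H10.comp Ω 1) + (H10.comp Ω 2).adjoint.comp (H10.comp Ω 2)
    + ((s : ℂ) ^ 2) • (H10.comp Ω 0).adjoint.comp (H10.comp Ω 0)

lemma inner_helmholtzOp (s : ℝ) (v h : H10 Ω) :
    ⟪v, helmholtzOp Ω s h⟫_ℂ = helmholtzForm s v h := by
  simp [helmholtzOp, helmholtzForm,
    ContinuousLinearMap.adjoint_inner_right]

lemma helmholtzForm_conj (s : ℝ) (v h : H10 Ω) :
    (starRingEnd ℂ) (helmholtzForm s v h) = helmholtzForm s h v := by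
  simp [helmholtzForm]

lemma helmholtzForm_self (s : ℝ) (v : H10 Ω) :
    helmholtzForm s v v = ((‖v.1 1‖ ^ 2 + ‖v.1 2‖ ^ 2 + s ^ 2 * ‖v.1 0‖ ^ 2 : ℝ) : ℂ) := by
  simp [helmholtzForm, inner_self_eq_norm_sq_to_K]

lemma helmholtz_coercive (s : ℝ) (v : H10 Ω) :
    min 1 (s ^ 2) * ‖v‖ ^ 2 ≤ ‖v.1 1‖ ^ 2 + ‖v.1 2‖ ^ 2 + s ^ 2 * ‖v.1 0‖ ^ 2 := by
  rw [H10.norm_sq_eq]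
  have h1 := min_le_left 1 (s ^ 2)
  have h2 := min_le_right 1 (s ^ 2)
  nlinarith [mul_le_mul_of_nonneg_right h1 (sq_nonneg ‖v.1 1‖),
    mul_le_mul_of_nonneg_right h1 (sq_nonneg ‖v.1 2‖),
    mul_le_mul_of_nonneg_right h2 (sq_nonneg ‖v.1 0‖)]

/-- Lax–Milgram: the form is coercive on `H¹₀` with constant `min 1 (s²)`. No Poincaré inequality is
needed because `s > 0`. -/
lemma isUnit_helmholtzOp {s : ℝ} (hs : 0 < s) : IsUnit (helmholtzOp Ω s) := by
  have hc : 0 < min 1 (s ^ 2) := lt_min one_pos (by positivity)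
  refine ContinuousLinearMap.isUnit_of_forall_le_norm_inner_map _ (c := ⟨min 1 (s ^ 2), hc.le⟩) hc
    fun v => ?_
  rw [← inner_conj_symm, RCLike.norm_conj, inner_helmholtzOp, helmholtzForm_self, Complex.norm_real]
  refine le_trans ?_ (le_abs_self _)
  rw [mul_comm]
  exact helmholtz_coercive s v

lemma exists_helmholtzForm_eq {s : ℝ} (hs : 0 < s) (f : H10 Ω) :
    ∃ h : H10 Ω, ∀ v, helmholtzForm s v h = ⟪v, f⟫_ℂ := by
  obtain ⟨T, hT⟩ := isUnit_helmholtzOp (Ω := Ω) hs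
  refine ⟨(↑T⁻¹ : H10 Ω →L[ℂ] H10 Ω) f, fun v => ?_⟩
  rw [← inner_helmholtzOp, ← hT, ← mul_apply_eq_comp, Units.mul_inv,
    one_apply_eq_self]

lemma eq_of_helmholtzForm_eq {s : ℝ} (hs : 0 < s) {h h' : H10 Ω}
    (hh : ∀ v, helmholtzForm s v h = helmholtzForm s v h') : h = h' := by
  obtain ⟨T, hT⟩ := isUnit_helmholtzOp (Ω := Ω) hs
  have h1 : helmholtzOp Ω s h = helmholtzOp Ω s h' :=
    ext_inner_left ℂ fun v => by rw [inner_helmholtzOp, inner_helmholtzOp, hh]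
  have h2 := congrArg (↑T⁻¹ : H10 Ω →L[ℂ] H10 Ω) h1
  rwa [← hT, ← mul_apply_eq_comp, ← mul_apply_eq_comp, Units.inv_mul,
    one_apply_eq_self] at h2

lemma exists_isLocalExpansion (b : ℝ) {s : ℝ} (hs : 0 < s) :
    ∃ h : ℕ → H10 (disk b), IsLocalExpansion b s h := by
  obtain ⟨h₀, hh₀⟩ := exists_helmholtzForm_eq hs ((H10.comp (disk b) 0).adjoint (one (disk b)))
  have step : ∀ g : H10 (disk b), ∃ h : H10 (disk b),
      ∀ v, helmholtzForm s v h = ⟪v.1 1, g.1 1⟫_ℂ := fun g => by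
    obtain ⟨h, hh⟩ := exists_helmholtzForm_eq hs
      ((H10.comp (disk b) 1).adjoint (H10.comp (disk b) 1 g))
    exact ⟨h, fun v => by rw [hh, ContinuousLinearMap.adjoint_inner_right]; rfl⟩
  choose K hK using step
  refine ⟨fun n => K^[n] h₀, fun v => ?_, fun n v => ?_⟩
  · exact (hh₀ v).trans (by rw [ContinuousLinearMap.adjoint_inner_right]; rfl)
  · simp only [Function.iterate_succ_apply']
    exact hK _ v

lemma IsLocalExpansion.unique {b s : ℝ} (hs : 0 < s) {h h' : ℕ → H10 (disk b)}
    (hh : IsLocalExpansion b s h) (hh' : IsLocalExpansion b s h') : h' = h := by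
  ext1 n
  induction n with
  | zero => exact eq_of_helmholtzForm_eq hs fun v => (hh'.1 v).trans (hh.1 v).symm
  | succ n ih =>
    refine eq_of_helmholtzForm_eq hs fun v => (hh'.2 n v).trans ?_
    rw [ih]
    exact (hh.2 n v).symm

/-- Testing the equation for `h (n+1)` with itself gives energy `⟪∂ₓh (n+1), ∂ₓh n⟫`. By
Cauchy–Schwarz and the arithmetic-geometric mean inequality this is at most half the sum of the two
consecutive energies, so the energy never increases. -/
lemma IsLocalExpansion.exists_bound {b s : ℝ} (hs : 0 < s) {h : ℕ → H10 (disk b)}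
    (hh : IsLocalExpansion b s h) : ∃ C, ∀ n, ‖h n‖ ≤ C := by
  let e : H10 (disk b) → ℝ := fun v => ‖v.1 1‖ ^ 2 + ‖v.1 2‖ ^ 2 + s ^ 2 * ‖v.1 0‖ ^ 2
  have he : ∀ v, ‖v.1 1‖ ^ 2 ≤ e v := fun v => by
    simp only [e]; nlinarith [sq_nonneg ‖v.1 2‖, sq_nonneg (s * ‖v.1 0‖)]
  have hanti : ∀ n, e (h (n + 1)) ≤ e (h n) := fun n => by
    have h1 : ((e (h (n + 1)) : ℝ) : ℂ) = ⟪(h (n + 1)).1 1, (h n).1 1⟫_ℂ := by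
      rw [← helmholtzForm_self]
      exact hh.2 n _
    have h2 : e (h (n + 1)) ≤ ‖(h (n + 1)).1 1‖ * ‖(h n).1 1‖ := by
      refine le_trans ?_ (norm_inner_le_norm (𝕜 := ℂ) _ _)
      rw [← h1, Complex.norm_real]
      exact le_abs_self _
    nlinarith [he (h (n + 1)), he (h n), sq_nonneg (‖(h (n + 1)).1 1‖ - ‖(h n).1 1‖)]
  have hbd : ∀ n, e (h n) ≤ e (h 0) := fun n => by
    induction n with
    | zero => exact le_rfl
    | succ n ih => exact (hanti n).trans ih
  have hc : 0 < min 1 (s ^ 2) := lt_min one_pos (by positivity)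
  refine ⟨Real.sqrt (e (h 0) / min 1 (s ^ 2)), fun n => Real.le_sqrt_of_sq_le ?_⟩
  rw [le_div_iff₀ hc, mul_comm]
  exact (helmholtz_coercive s (h n)).trans (hbd n)

lemma IsLocalExpansion.hasSum {b s : ℝ} (hs : 0 < s) {h : ℕ → H10 (disk b)}
    (hh : IsLocalExpansion b s h) {l : ℝ} (hl0 : 0 ≤ l) (hl1 : l < 1) :
    ∃ w : H10 (disk b), HasSum (fun n => ((l : ℂ) ^ n) • h n) w ∧
      ∀ v : H10 (disk b), (1 - l : ℂ) * ⟪v.1 1, w.1 1⟫_ℂ + ⟪v.1 2, w.1 2⟫_ℂ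
        + (s : ℂ) ^ 2 * ⟪v.1 0, w.1 0⟫_ℂ = ⟪v.1 0, one (disk b)⟫_ℂ := by
  obtain ⟨C, hC⟩ := hh.exists_bound hs
  have hsum : Summable fun n => ((l : ℂ) ^ n) • h n := by
    refine Summable.of_norm_bounded ((summable_geometric_of_lt_one hl0 hl1).mul_right C) fun n => ?_
    rw [norm_smul, norm_pow, Complex.norm_real, Real.norm_of_nonneg hl0]
    exact mul_le_mul_of_nonneg_left (hC n) (by positivity)
  refine ⟨_, hsum.hasSum, fun v => ?_⟩
  set w := ∑' n, ((l : ℂ) ^ n) • h n with hw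
  have hform : HasSum (fun n => (l : ℂ) ^ n * helmholtzForm s v (h n)) (helmholtzForm s v w) := by
    have := hsum.hasSum.mapL ((innerSL ℂ v).comp (helmholtzOp (disk b) s))
    simpa [inner_helmholtzOp, inner_smul_right, -Submodule.coe_inner] using this
  have hx : HasSum (fun n => (l : ℂ) ^ n * ⟪v.1 1, (h n).1 1⟫_ℂ) ⟪v.1 1, w.1 1⟫_ℂ := by
    have := hsum.hasSum.mapL ((innerSL ℂ (v.1 1)).comp (H10.comp (disk b) 1))
    simpa [inner_smul_right] using this
  have h2 : HasSum (fun n => (l : ℂ) ^ (n + 1) * helmholtzForm s v (h (n + 1)))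
      (l * ⟪v.1 1, w.1 1⟫_ℂ) := by
    refine (hx.mul_left (l : ℂ)).congr_fun ?_
    intro n
    rw [show helmholtzForm s v (h (n + 1)) = _ from hh.2 n v]
    ring
  -- Splitting off the term `n = 0` and using the recursion on the rest sums the series back to `λ`
  -- times the `∂ₓ` pairing. Moving it to the left produces the coefficient `1 - λ`.
  have h3 : helmholtzForm s v w = ⟪v.1 0, one (disk b)⟫_ℂ + l * ⟪v.1 1, w.1 1⟫_ℂ := by
    rw [← hform.tsum_eq, hform.summable.tsum_eq_zero_add, h2.tsum_eq,
      show helmholtzForm s v (h 0) = _ from hh.1 v]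
    simp
  rw [helmholtzForm] at h3
  linear_combination h3

/-- The pairings `⟪h i, h j⟫` of the expansion in the form depend only on `i + j`. -/
lemma IsLocalExpansion.form_shift {b s : ℝ} {h : ℕ → H10 (disk b)}
    (hh : IsLocalExpansion b s h) (i j : ℕ) :
    helmholtzForm s (h i) (h (j + 1)) = helmholtzForm s (h (i + 1)) (h j) := by
  rw [← helmholtzForm_conj s (h j), show helmholtzForm s (h i) (h (j + 1)) = _ from hh.2 j _,
    show helmholtzForm s (h j) (h (i + 1)) = _ from hh.2 i _, inner_conj_symm]

lemma IsLocalExpansion.form_eq {b s : ℝ} {h : ℕ → H10 (disk b)}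
    (hh : IsLocalExpansion b s h) (i j : ℕ) :
    helmholtzForm s (h i) (h j) = helmholtzForm s (h (i + j)) (h 0) := by
  induction j generalizing i with
  | zero => rfl
  | succ j ih => rw [hh.form_shift, ih, show i + 1 + j = i + (j + 1) by ring]

/-- The equation of `h 0` turns pairing with `1` into the form against `h 0`, and symmetry then
distributes the index freely. This halves the order to which the expansion must be solved
explicitly. -/
lemma IsLocalExpansion.inner_one {b s : ℝ} {h : ℕ → H10 (disk b)}
    (hh : IsLocalExpansion b s h) (i j : ℕ) :
    ⟪one (disk b), (h (i + j)).1 0⟫_ℂ = helmholtzForm s (h i) (h j) := by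
  rw [← inner_conj_symm, ← show helmholtzForm s (h (i + j)) (h 0) = _ from hh.1 _,
    helmholtzForm_conj, hh.form_eq 0, zero_add, hh.form_eq i]

end HeatContent

/-! ### Laplace transform of the heat semigroup as a resolvent -/

namespace HeatContent

/-- Only `x = 0` is delicate: `exp(t/x) ≥ t/x` bounds the symbol by `eᵗ x/t`, which tends to `0`
locally uniformly in `t > 0`. Joint continuity is what permits exchanging the `t`-integral with the
functional calculus. -/
lemma continuousOn_heatSymbol :
    ContinuousOn (Function.uncurry fun t x : ℝ => if x = 0 then 0 else Real.exp (-t * (1 / x - 1)))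
      (Ioi 0 ×ˢ Icc 0 1) := by
  rintro ⟨t, x⟩ ⟨ht, hx⟩
  simp only [mem_Ioi] at ht
  rcases eq_or_ne x 0 with rfl | hx0
  · have hlim : Filter.Tendsto (fun p : ℝ × ℝ => Real.exp p.1 * (p.2 / p.1))
        (nhdsWithin (t, 0) (Ioi 0 ×ˢ Icc 0 1)) (nhds 0) := by
      have : ContinuousAt (fun p : ℝ × ℝ => Real.exp p.1 * (p.2 / p.1)) (t, 0) :=
        (Real.continuous_exp.continuousAt.comp continuousAt_fst).mul
          (continuousAt_snd.div continuousAt_fst ht.ne')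
      simpa [ContinuousAt] using this.tendsto.mono_left nhdsWithin_le_nhds
    rw [ContinuousWithinAt]
    simp only [Function.uncurry, if_true]
    refine squeeze_zero' (Filter.Eventually.of_forall fun p => ?_) ?_ hlim
    · simp only [Function.uncurry]
      split_ifs <;> positivity
    · filter_upwards [self_mem_nhdsWithin] with p hp
      have hp1 : 0 < p.1 := hp.1
      simp only [Function.uncurry]
      split_ifs with h0
      · simp [h0]
      · have hp2 : 0 < p.2 := lt_of_le_of_ne hp.2.1 (Ne.symm h0)
        rw [show -p.1 * (1 / p.2 - 1) = p.1 + -(p.1 / p.2) by field_simp; ring, Real.exp_add,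
          Real.exp_neg]
        gcongr
        rw [← inv_div p.1 p.2]
        exact inv_anti₀ (by positivity) (by linarith [Real.add_one_le_exp (p.1 / p.2)])
  · have h1 : ContinuousAt (fun p : ℝ × ℝ => Real.exp (-p.1 * (1 / p.2 - 1))) (t, x) :=
      Real.continuous_exp.continuousAt.comp
        (continuousAt_fst.neg.mul ((continuousAt_const.div continuousAt_snd hx0).sub
          continuousAt_const))
    refine (h1.congr ?_).continuousWithinAt
    filter_upwards [continuousAt_snd.eventually_ne hx0] with p hp
    simp [Function.uncurry, hp]

lemma integral_heatSymbol {s x : ℝ} (hs : 0 < s) (hx : x ∈ Icc (0 : ℝ) 1) :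
    ∫ t in Ioi (0 : ℝ), Real.exp (-s ^ 2 * t) *
      (if x = 0 then 0 else Real.exp (-t * (1 / x - 1))) = x * (1 + (s ^ 2 - 1) * x)⁻¹ := by
  rcases eq_or_ne x 0 with rfl | hx0
  · simp
  · have hx1 : 0 < x := lt_of_le_of_ne hx.1 (Ne.symm hx0)
    have h1 : 1 ≤ 1 / x := by rw [le_div_iff₀ hx1]; linarith [hx.2]
    have h2 : -(s ^ 2 + (1 / x - 1)) < 0 := by nlinarith [sq_pos_of_pos hs]
    -- The quantity equals `(1 - x) + s² x`.
    have h3 : 0 < 1 + (s ^ 2 - 1) * x := by nlinarith [mul_pos (sq_pos_of_pos hs) hx1, hx.2]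
    simp only [hx0, if_false, ← Real.exp_add]
    have h4 : ∀ t, -s ^ 2 * t + -t * (1 / x - 1) = -(s ^ 2 + (1 / x - 1)) * t := fun t => by ring
    simp only [h4]
    rw [integral_exp_mul_Ioi h2 0]
    have h5 : s ^ 2 + (1 / x - 1) = (1 + (s ^ 2 - 1) * x) / x := by field_simp; ring
    rw [h5]
    simp
    field_simp

variable {H : Type*} [NormedAddCommGroup H] [InnerProductSpace ℂ H] [CompleteSpace H]

/-- The Laplace transform of `exp(-tA)` is the resolvent `(s² + A)⁻¹ = T (1 + (s² - 1) T)⁻¹`. -/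
lemma laplace_expOfResolvent {T : H →L[ℂ] H} (hT : IsSelfAdjoint T)
    (hsp : spectrum ℝ T ⊆ Icc 0 1) {s : ℝ} (hs : 0 < s) :
    IntegrableOn (fun t => Real.exp (-s ^ 2 * t) • expOfResolvent T t) (Ioi 0) ∧
    ∃ R : H →L[ℂ] H, ∫ t in Ioi (0 : ℝ), Real.exp (-s ^ 2 * t) • expOfResolvent T t = T * R ∧
      R + (s ^ 2 - 1) • (T * R) = 1 := by
  have hcont : ∀ t ∈ Ioi (0 : ℝ),
      ContinuousOn (fun x : ℝ => if x = 0 then 0 else Real.exp (-t * (1 / x - 1)))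
        (spectrum ℝ T) := fun t ht =>
    continuousOn_heatSymbol.comp (Continuous.prodMk_right t).continuousOn fun x hx => ⟨ht, hsp hx⟩
  have hF : ∀ t ∈ Ioi (0 : ℝ), cfc (fun x : ℝ => Real.exp (-s ^ 2 * t) *
      (if x = 0 then 0 else Real.exp (-t * (1 / x - 1)))) T
        = Real.exp (-s ^ 2 * t) • expOfResolvent T t := fun t ht => by
    rw [expOfResolvent, cfc_const_mul _ _ _ (hcont t ht)]
  have hjoint : ContinuousOn (Function.uncurry fun t x : ℝ => Real.exp (-s ^ 2 * t) *
      (if x = 0 then 0 else Real.exp (-t * (1 / x - 1)))) (Ioi 0 ×ˢ spectrum ℝ T) := by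
    refine ContinuousOn.mul (f := fun p : ℝ × ℝ => Real.exp (-s ^ 2 * p.1)) ?_
      (continuousOn_heatSymbol.mono (prod_mono le_rfl hsp))
    fun_prop
  -- Since `1/x - 1 ≥ 0` on `(0, 1]`, the heat symbol is at most `1`, leaving an integrable
  -- majorant.
  have hbound : ∀ᵐ t ∂(volume.restrict (Ioi (0 : ℝ))), ∀ x ∈ spectrum ℝ T,
      ‖Real.exp (-s ^ 2 * t) * (if x = 0 then 0 else Real.exp (-t * (1 / x - 1)))‖
        ≤ Real.exp (-s ^ 2 * t) := by
    refine ae_restrict_of_forall_mem measurableSet_Ioi fun t ht x hx => ?_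
    have ht' : 0 < t := ht
    rw [norm_mul, Real.norm_of_nonneg (Real.exp_pos _).le]
    refine mul_le_of_le_one_right (Real.exp_pos _).le ?_
    split_ifs with h0
    · simp
    · have hx1 : 0 < x := lt_of_le_of_ne (hsp hx).1 (Ne.symm h0)
      have h1 : 1 ≤ 1 / x := by rw [le_div_iff₀ hx1]; linarith [(hsp hx).2]
      rw [Real.norm_of_nonneg (Real.exp_pos _).le, Real.exp_le_one_iff]
      nlinarith
  have hfin : HasFiniteIntegral (fun t => Real.exp (-s ^ 2 * t)) (volume.restrict (Ioi (0 : ℝ))) :=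
    (integrableOn_exp_mul_Ioi (by nlinarith [sq_pos_of_pos hs]) 0).2
  have hint := integrableOn_cfc measurableSet_Ioi _ _ T hjoint hbound hfin hT
  refine ⟨hint.congr_fun hF measurableSet_Ioi, cfc (fun x : ℝ => (1 + (s ^ 2 - 1) * x)⁻¹) T, ?_⟩
  have hpos : ∀ x ∈ spectrum ℝ T, 0 < 1 + (s ^ 2 - 1) * x := fun x hx => by
    rcases eq_or_lt_of_le (hsp hx).1 with h0 | h0
    · rw [← h0]; simp
    · nlinarith [mul_pos (sq_pos_of_pos hs) h0, (hsp hx).2]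
  have hinv : ContinuousOn (fun x : ℝ => (1 + (s ^ 2 - 1) * x)⁻¹) (spectrum ℝ T) :=
    ContinuousOn.inv₀ (by fun_prop) fun x hx => (hpos x hx).ne'
  have hTR : T * cfc (fun x : ℝ => (1 + (s ^ 2 - 1) * x)⁻¹) T
      = cfc (fun x : ℝ => x * (1 + (s ^ 2 - 1) * x)⁻¹) T := by
    rw [cfc_mul (fun x => x) _ T continuousOn_id hinv, cfc_id' ℝ T]
  constructor
  · rw [← setIntegral_congr_fun measurableSet_Ioi hF,
      ← cfc_setIntegral measurableSet_Ioi _ _ T hjoint hbound hfin hT, hTR]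
    exact cfc_congr fun x hx => integral_heatSymbol hs (hsp hx)
  · have hmul : ContinuousOn (fun x : ℝ => x * (1 + (s ^ 2 - 1) * x)⁻¹) (spectrum ℝ T) :=
      continuousOn_id.mul hinv
    have hmul' : ContinuousOn (fun x : ℝ => (s ^ 2 - 1) • (x * (1 + (s ^ 2 - 1) * x)⁻¹))
        (spectrum ℝ T) := continuousOn_const.mul hmul
    rw [hTR, ← cfc_smul _ _ _ hmul, ← cfc_add _ _ _ hinv hmul', ← cfc_one ℝ T]
    refine cfc_congr fun x hx => ?_
    have := (hpos x hx).ne'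
    simp only [Pi.one_apply, smul_eq_mul]
    field_simp
    
variable {Ω : Set (ℝ × ℝ)}

lemma isPositive_dirichletResolvent : (dirichletResolvent Ω).IsPositive :=
  ContinuousLinearMap.isPositive_self_comp_adjoint _

lemma norm_dirichletResolvent_le : ‖dirichletResolvent Ω‖ ≤ 1 := by
  have h1 : ‖H10.toL2 Ω‖ ≤ 1 := ContinuousLinearMap.opNorm_le_bound _ zero_le_one fun v => by
    rw [one_mul, H10.toL2_apply]
    exact PiLp.norm_apply_le v.1 0
  refine (ContinuousLinearMap.opNorm_comp_le _ _).trans ?_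
  rw [LinearIsometryEquiv.norm_map]
  nlinarith [norm_nonneg (H10.toL2 Ω)]

lemma spectrum_dirichletResolvent_subset : spectrum ℝ (dirichletResolvent Ω) ⊆ Icc 0 1 := by
  intro x hx
  have h0 : 0 ≤ x := spectrum_nonneg_of_nonneg
    ((ContinuousLinearMap.nonneg_iff_isPositive _).2 isPositive_dirichletResolvent) hx
  refine ⟨h0, ?_⟩
  have h1 := spectrum.norm_le_norm_mul_of_mem hx
  have h2 : ‖(1 : L2 Ω →L[ℂ] L2 Ω)‖ ≤ 1 := ContinuousLinearMap.norm_id_le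
  rw [Real.norm_of_nonneg h0] at h1
  nlinarith [norm_dirichletResolvent_le (Ω := Ω), norm_nonneg (dirichletResolvent Ω),
    norm_nonneg (1 : L2 Ω →L[ℂ] L2 Ω)]

lemma one_ae_eq (hΩ : volume Ω ≠ ⊤) : one Ω =ᵐ[volume.restrict Ω] fun _ => (1 : ℂ) := by
  have : IsFiniteMeasure (volume.restrict Ω) := isFiniteMeasure_restrict.2 hΩ
  rw [one, dif_pos (memLp_const 1)]
  exact MemLp.coeFn_toLp _

lemma inner_one_eq (hΩ : volume Ω ≠ ⊤) (u : L2 Ω) : ⟪one Ω, u⟫_ℂ = ∫ p in Ω, u p := by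
  rw [L2.inner_def]
  refine integral_congr_ae ?_
  filter_upwards [one_ae_eq hΩ] with p hp
  simp [hp]

/-- The mean value as a continuous linear functional. -/
noncomputable def meanL (Ω : Set (ℝ × ℝ)) : L2 Ω →L[ℂ] ℂ :=
  (((volume Ω).toReal⁻¹ : ℝ) : ℂ) • innerSL ℂ (one Ω)

lemma mean_eq_meanL (hΩ : volume Ω ≠ ⊤) (u : L2 Ω) : mean Ω u = meanL Ω u := by
  simp [mean, meanL, inner_one_eq hΩ]

/-- The mean after evaluation at `1` is a bounded functional of the operator, so it passes through
the Bochner integral. What remains is to identify `T R 1` with the weak solution. -/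
lemma heatContentLaplace_eq (hΩ : volume Ω ≠ ⊤) {s : ℝ} (hs : 0 < s) {w : H10 Ω}
    (hw : ∀ v : H10 Ω, helmholtzForm s v w = ⟪v.1 0, one Ω⟫_ℂ) :
    IntegrableOn (fun t => Real.exp (-s ^ 2 * t) * heatContent Ω t) (Ioi 0) ∧
      heatContentLaplace Ω s = (mean Ω (w.1 0)).re := by
  obtain ⟨hint, R, hR, hR1⟩ := laplace_expOfResolvent
    (isPositive_dirichletResolvent (Ω := Ω)).isSelfAdjoint spectrum_dirichletResolvent_subset hs
  let ℓ : (L2 Ω →L[ℂ] L2 Ω) →L[ℝ] ℝ := Complex.reCLM.comp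
    (((meanL Ω).comp (ContinuousLinearMap.apply ℂ (L2 Ω) (one Ω))).restrictScalars ℝ)
  have hℓ : ∀ S : L2 Ω →L[ℂ] L2 Ω, ℓ S = (mean Ω (S (one Ω))).re := fun S => by
    rw [mean_eq_meanL hΩ]; rfl
  have hfun : (fun t => Real.exp (-s ^ 2 * t) * heatContent Ω t)
      = fun t => ℓ (Real.exp (-s ^ 2 * t) • expOfResolvent (dirichletResolvent Ω) t) := by
    ext t
    rw [map_smul, hℓ]
    rfl
  refine ⟨hfun ▸ ℓ.integrable_comp hint, ?_⟩
  rw [heatContentLaplace, hfun]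
  refine ((ℓ.integral_comp_comm hint).trans (congrArg ℓ hR)).trans ?_
  rw [hℓ]
  -- With `T = J J†`, the vector `J† (R 1)` solves the equation at `s = 1` with right side `R 1`.
  -- The relation `R 1 = 1 - (s² - 1) T R 1` moves the difference into the zeroth-order term, and
  -- uniqueness finishes.
  have hw' : w = (H10.toL2 Ω).adjoint (R (one Ω)) := by
    refine eq_of_helmholtzForm_eq hs fun v => ?_
    set w' := (H10.toL2 Ω).adjoint (R (one Ω)) with hw'
    have h1 : R (one Ω) + ((s ^ 2 - 1 : ℝ) : ℂ) • w'.1 0 = one Ω := by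
      have := congrArg (fun S : L2 Ω →L[ℂ] L2 Ω => S (one Ω)) hR1
      exact this
    have h2 : ⟪v, w'⟫_ℂ = ⟪v.1 0, R (one Ω)⟫_ℂ := by
      rw [hw', ContinuousLinearMap.adjoint_inner_right]; rfl
    rw [hw, ← h1, inner_add_right, ← h2, H10.inner_eq, helmholtzForm, inner_smul_right]
    push_cast
    ring
  rw [hw']
  rfl

end HeatContent

/-! ### Stretching the ellipse to the disk -/

namespace HeatContent

variable {Ω Ω' : Set (ℝ × ℝ)} {k : ℝ}

/-- The linear map `(x, y) ↦ (k x, y)`. -/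
noncomputable def stretch (k : ℝ) : ℝ × ℝ →L[ℝ] ℝ × ℝ :=
  (k • ContinuousLinearMap.fst ℝ ℝ ℝ).prod (ContinuousLinearMap.snd ℝ ℝ ℝ)

@[simp] lemma stretch_apply (k : ℝ) (p : ℝ × ℝ) : stretch k p = (k * p.1, p.2) := rfl

lemma stretch_stretch_inv (hk : 0 < k) (p : ℝ × ℝ) : stretch k (stretch k⁻¹ p) = p := by
  ext <;> simp [hk.ne']

lemma stretch_inv_stretch (hk : 0 < k) (p : ℝ × ℝ) : stretch k⁻¹ (stretch k p) = p := by
  ext <;> simp [hk.ne']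

lemma measurePreserving_stretch (hk : 0 < k) :
    MeasurePreserving (stretch k) volume (ENNReal.ofReal k⁻¹ • volume) := by
  refine ⟨(stretch k).continuous.measurable, ?_⟩
  have h1 : (stretch k : ℝ × ℝ → ℝ × ℝ) = Prod.map (k * ·) id := rfl
  rw [h1, Measure.volume_eq_prod, ← Measure.map_prod_map _ _ (by fun_prop) measurable_id,
    Real.map_volume_mul_left hk.ne', Measure.map_id, Measure.prod_smul_left,
    abs_of_pos (inv_pos.2 hk)]

lemma measurePreserving_stretch_restrict (hk : 0 < k) (hΩ : MeasurableSet Ω)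
    (h : Ω' = stretch k ⁻¹' Ω) :
    MeasurePreserving (stretch k) (volume.restrict Ω')
      (ENNReal.ofReal k⁻¹ • volume.restrict Ω) := by
  rw [← Measure.restrict_smul, h]
  exact (measurePreserving_stretch hk).restrict_preimage hΩ

lemma ae_stretch (hk : 0 < k) (hΩ : MeasurableSet Ω) (h : Ω' = stretch k ⁻¹' Ω)
    {P : ℝ × ℝ → Prop} (hP : ∀ᵐ p ∂volume.restrict Ω, P p) :
    ∀ᵐ p ∂volume.restrict Ω', P (stretch k p) :=
  (measurePreserving_stretch_restrict hk hΩ h).quasiMeasurePreserving.ae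
    (Measure.ae_smul_measure hP _)

lemma memLp_comp_stretch (hk : 0 < k) (hΩ : MeasurableSet Ω) (h : Ω' = stretch k ⁻¹' Ω)
    (u : L2 Ω) : MemLp (u ∘ stretch k) 2 (volume.restrict Ω') :=
  ((Lp.memLp u).smul_measure ENNReal.ofReal_ne_top).comp_measurePreserving
    (measurePreserving_stretch_restrict hk hΩ h)

/-- Composition with `stretch k`, as a linear map on `L²`. -/
noncomputable def pullₗ (hk : 0 < k) (hΩ : MeasurableSet Ω) (h : Ω' = stretch k ⁻¹' Ω) :
    L2 Ω →ₗ[ℂ] L2 Ω' where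
  toFun u := (memLp_comp_stretch hk hΩ h u).toLp
  map_add' u v := by
    rw [← MemLp.toLp_add, MemLp.toLp_eq_toLp_iff]
    exact ae_stretch hk hΩ h (Lp.coeFn_add u v)
  map_smul' c u := by
    rw [RingHom.id_apply, ← MemLp.toLp_const_smul, MemLp.toLp_eq_toLp_iff]
    exact ae_stretch hk hΩ h (Lp.coeFn_smul c u)

lemma pullₗ_ae_eq (hk : 0 < k) (hΩ : MeasurableSet Ω) (h : Ω' = stretch k ⁻¹' Ω) (u : L2 Ω) :
    pullₗ hk hΩ h u =ᵐ[volume.restrict Ω'] u ∘ stretch k :=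
  MemLp.coeFn_toLp (memLp_comp_stretch hk hΩ h u)

lemma measurableEmbedding_stretch (hk : 0 < k) : MeasurableEmbedding (stretch k) :=
  (MeasurableEquiv.mk ⟨stretch k, stretch k⁻¹, stretch_inv_stretch hk, stretch_stretch_inv hk⟩
    (stretch k).continuous.measurable (stretch k⁻¹).continuous.measurable).measurableEmbedding

lemma integral_comp_stretch (hk : 0 < k) (hΩ : MeasurableSet Ω) (h : Ω' = stretch k ⁻¹' Ω)
    (g : ℝ × ℝ → ℂ) : ∫ p in Ω', g (stretch k p) = (k⁻¹ : ℂ) * ∫ p in Ω, g p := by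
  rw [(measurePreserving_stretch_restrict hk hΩ h).integral_comp
    (measurableEmbedding_stretch hk), integral_smul_measure,
    ENNReal.toReal_ofReal (inv_pos.2 hk).le, Complex.real_smul, Complex.ofReal_inv]

lemma inner_pullₗ (hk : 0 < k) (hΩ : MeasurableSet Ω) (h : Ω' = stretch k ⁻¹' Ω) (u v : L2 Ω) :
    ⟪pullₗ hk hΩ h u, pullₗ hk hΩ h v⟫_ℂ = (k⁻¹ : ℂ) * ⟪u, v⟫_ℂ := by
  rw [L2.inner_def, L2.inner_def, ← integral_comp_stretch hk hΩ h]
  refine integral_congr_ae ?_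
  filter_upwards [pullₗ_ae_eq hk hΩ h u, pullₗ_ae_eq hk hΩ h v] with p h1 h2
  rw [h1, h2]
  rfl

/-- Composition with `stretch k`, as a continuous linear map on `L²`. -/
noncomputable def pull (hk : 0 < k) (hΩ : MeasurableSet Ω) (h : Ω' = stretch k ⁻¹' Ω) :
    L2 Ω →L[ℂ] L2 Ω' :=
  (pullₗ hk hΩ h).mkContinuous (Real.sqrt k⁻¹) fun u => by
    have h1 := inner_pullₗ hk hΩ h u u
    rw [inner_self_eq_norm_sq_to_K, inner_self_eq_norm_sq_to_K] at h1
    have h2 : ‖pullₗ hk hΩ h u‖ ^ 2 = k⁻¹ * ‖u‖ ^ 2 :=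
      Complex.ofReal_injective (by push_cast; exact h1)
    rw [← Real.sqrt_sq (norm_nonneg u), ← Real.sqrt_mul (inv_pos.2 hk).le, ← h2,
      Real.sqrt_sq (norm_nonneg _)]

lemma pull_ae_eq (hk : 0 < k) (hΩ : MeasurableSet Ω) (h : Ω' = stretch k ⁻¹' Ω) (u : L2 Ω) :
    pull hk hΩ h u =ᵐ[volume.restrict Ω'] u ∘ stretch k :=
  pullₗ_ae_eq hk hΩ h u

lemma inner_pull (hk : 0 < k) (hΩ : MeasurableSet Ω) (h : Ω' = stretch k ⁻¹' Ω) (u v : L2 Ω) :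
    ⟪pull hk hΩ h u, pull hk hΩ h v⟫_ℂ = (k⁻¹ : ℂ) * ⟪u, v⟫_ℂ :=
  inner_pullₗ hk hΩ h u v

lemma pull_pull_inv (hk : 0 < k) (hΩ : MeasurableSet Ω) (hΩ' : MeasurableSet Ω')
    (h : Ω' = stretch k ⁻¹' Ω) (h' : Ω = stretch k⁻¹ ⁻¹' Ω') (u : L2 Ω') :
    pull hk hΩ h (pull (inv_pos.2 hk) hΩ' h' u) = u := by
  refine Lp.ext ?_
  filter_upwards [pull_ae_eq hk hΩ h (pull (inv_pos.2 hk) hΩ' h' u),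
    ae_stretch hk hΩ h (pull_ae_eq (inv_pos.2 hk) hΩ' h' u)] with p h1 h2
  rw [h1, Function.comp_apply, h2, Function.comp_apply, stretch_inv_stretch hk]

lemma pull_one (hk : 0 < k) (hΩ : MeasurableSet Ω) (hfin : volume Ω ≠ ⊤) (hfin' : volume Ω' ≠ ⊤)
    (h : Ω' = stretch k ⁻¹' Ω) : pull hk hΩ h (one Ω) = one Ω' := by
  refine Lp.ext ?_
  filter_upwards [pull_ae_eq hk hΩ h (one Ω), ae_stretch hk hΩ h (one_ae_eq hfin),
    one_ae_eq hfin'] with p h1 h2 h3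
  rw [h1, Function.comp_apply, h2, h3]

lemma mean_pull (hk : 0 < k) (hΩ : MeasurableSet Ω) (h : Ω' = stretch k ⁻¹' Ω) (u : L2 Ω) :
    mean Ω' (pull hk hΩ h u) = mean Ω u := by
  have hvol : volume Ω' = ENNReal.ofReal k⁻¹ * volume Ω := by
    rw [h, (measurePreserving_stretch hk).measure_preimage hΩ.nullMeasurableSet]
    rfl
  have hint : ∫ p in Ω', pull hk hΩ h u p = (k⁻¹ : ℂ) * ∫ p in Ω, u p := by
    rw [← integral_comp_stretch hk hΩ h]
    exact integral_congr_ae (pull_ae_eq hk hΩ h u)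
  rw [mean, mean, hint, hvol, ENNReal.toReal_mul, ENNReal.toReal_ofReal (inv_pos.2 hk).le]
  have : (k : ℂ) ≠ 0 := by exact_mod_cast hk.ne'
  push_cast
  rw [mul_inv, inv_inv]
  field_simp

/-- The action of composition with `stretch k` on functions together with their gradient. -/
noncomputable def pullJet (hk : 0 < k) (hΩ : MeasurableSet Ω) (h : Ω' = stretch k ⁻¹' Ω) :
    Jet Ω →L[ℂ] Jet Ω' :=
  (PiLp.continuousLinearEquiv 2 ℂ (fun _ : Fin 3 => L2 Ω')).symm.toContinuousLinearMap.comp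
    -- By the chain rule only the `x`-derivative acquires a factor `k`.
    (ContinuousLinearMap.pi fun i => (![1, (k : ℂ), 1] i) •
      (pull hk hΩ h).comp (PiLp.proj 2 (fun _ : Fin 3 => L2 Ω) i))

lemma pullJet_apply (hk : 0 < k) (hΩ : MeasurableSet Ω) (h : Ω' = stretch k ⁻¹' Ω) (w : Jet Ω)
    (i : Fin 3) : pullJet hk hΩ h w i = (![1, (k : ℂ), 1] i) • pull hk hΩ h (w i) := rfl

lemma IsTestFunction.comp_stretch (hk : 0 < k) (h : Ω' = stretch k ⁻¹' Ω) {f : ℝ × ℝ → ℂ}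
    (hf : IsTestFunction Ω f) : IsTestFunction Ω' (f ∘ stretch k) := by
  obtain ⟨h1, h2, h3⟩ := hf
  let e : ℝ × ℝ ≃ₜ ℝ × ℝ :=
    { toFun := stretch k
      invFun := stretch k⁻¹
      left_inv := stretch_inv_stretch hk
      right_inv := stretch_stretch_inv hk
      continuous_toFun := (stretch k).continuous
      continuous_invFun := (stretch k⁻¹).continuous }
  refine ⟨h1.comp (stretch k).contDiff, h2.comp_homeomorph e, ?_⟩
  rw [h]
  exact (tsupport_comp_subset_preimage f (stretch k).continuous).trans (preimage_mono h3)

lemma fderiv_comp_stretch {f : ℝ × ℝ → ℂ} (hf : Differentiable ℝ f) (p v : ℝ × ℝ) :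
    fderiv ℝ (f ∘ stretch k) p v = fderiv ℝ f (stretch k p) (stretch k v) := by
  rw [((hf _).hasFDerivAt.comp p (stretch k).hasFDerivAt).fderiv]
  rfl

lemma IsJetOf.pullJet (hk : 0 < k) (hΩ : MeasurableSet Ω) (h : Ω' = stretch k ⁻¹' Ω)
    {w : Jet Ω} {f : ℝ × ℝ → ℂ} (hf : Differentiable ℝ f) (hw : IsJetOf Ω w f) :
    IsJetOf Ω' (pullJet hk hΩ h w) (f ∘ stretch k) := by
  obtain ⟨h0, h1, h2⟩ := hw
  refine ⟨?_, ?_, ?_⟩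
  · rw [pullJet_apply]
    simp only [Matrix.cons_val_zero, one_smul]
    filter_upwards [pull_ae_eq hk hΩ h (w 0), ae_stretch hk hΩ h h0] with p e1 e2
    rw [e1, Function.comp_apply, e2, Function.comp_apply]
  · rw [pullJet_apply]
    filter_upwards [Lp.coeFn_smul (![1, (k : ℂ), 1] 1) (pull hk hΩ h (w 1)),
      pull_ae_eq hk hΩ h (w 1), ae_stretch hk hΩ h h1] with p e0 e1 e2
    rw [e0, Pi.smul_apply, e1, Function.comp_apply, e2, fderiv_comp_stretch hf,
      show stretch k (1, 0) = k • ((1, 0) : ℝ × ℝ) by simp, map_smul]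
    simp
  · rw [pullJet_apply]
    have : (![1, (k : ℂ), 1] 2) = 1 := rfl
    rw [this, one_smul]
    filter_upwards [pull_ae_eq hk hΩ h (w 2), ae_stretch hk hΩ h h2] with p e1 e2
    rw [e1, Function.comp_apply, e2, fderiv_comp_stretch hf]
    simp

/-- `H¹₀` is a closed span of test functions, so a continuous linear map need only be checked on
their jets. -/
lemma map_mem_H10 (L : Jet Ω →L[ℂ] Jet Ω')
    (hL : ∀ (f : ℝ × ℝ → ℂ) (w : Jet Ω), IsTestFunction Ω f → IsJetOf Ω w f → L w ∈ H10 Ω')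
    {w : Jet Ω} (hw : w ∈ H10 Ω) : L w ∈ H10 Ω' := by
  have key : H10 Ω ≤ (H10 Ω').comap L.toLinearMap := by
    refine Submodule.topologicalClosure_minimal _ (Submodule.span_le.2 ?_)
      ((Submodule.isClosed_topologicalClosure _).preimage L.continuous)
    rintro v ⟨f, hf, hv⟩
    exact hL f v hf hv
  exact key hw

lemma IsTestFunction.mem_H10 {f : ℝ × ℝ → ℂ} (hf : IsTestFunction Ω f) {w : Jet Ω}
    (hw : IsJetOf Ω w f) : w ∈ H10 Ω :=
  Submodule.le_topologicalClosure _ (Submodule.subset_span ⟨f, hf, hw⟩)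

lemma pullJet_mem (hk : 0 < k) (hΩ : MeasurableSet Ω) (h : Ω' = stretch k ⁻¹' Ω)
    {w : Jet Ω} (hw : w ∈ H10 Ω) : pullJet hk hΩ h w ∈ H10 Ω' :=
  map_mem_H10 _ (fun _ _ hf hv =>
    (hf.comp_stretch hk h).mem_H10 (hv.pullJet hk hΩ h (hf.1.differentiable (by simp)))) hw

/-- A weak solution of the stretched equation on `Ω` gives one of the Helmholtz equation on the
preimage of `Ω`. -/
lemma helmholtzForm_pullJet (hk : 0 < k) (hΩ : MeasurableSet Ω) (hΩ' : MeasurableSet Ω')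
    (hfin : volume Ω ≠ ⊤) (hfin' : volume Ω' ≠ ⊤)
    (h : Ω' = stretch k ⁻¹' Ω) (h' : Ω = stretch k⁻¹ ⁻¹' Ω') {s : ℝ} {w : H10 Ω}
    (hw : ∀ v : H10 Ω, (k : ℂ) ^ 2 * ⟪v.1 1, w.1 1⟫_ℂ + ⟪v.1 2, w.1 2⟫_ℂ
        + (s : ℂ) ^ 2 * ⟪v.1 0, w.1 0⟫_ℂ = ⟪v.1 0, one Ω⟫_ℂ) (v : H10 Ω') :
    helmholtzForm s v ⟨pullJet hk hΩ h w.1, pullJet_mem hk hΩ h w.2⟩ = ⟪v.1 0, one Ω'⟫_ℂ := by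
  have hk' : (k : ℂ) ≠ 0 := by exact_mod_cast hk.ne'
  -- Each test element on `Ω'` is a pullback. All pairings then carry the same Jacobian `k⁻¹`, and
  -- the two `x`-derivatives supply the extra `k²`.
  let v' : H10 Ω := ⟨pullJet (inv_pos.2 hk) hΩ' h' v.1, pullJet_mem _ hΩ' h' v.2⟩
  have e0 : v.1 0 = pull hk hΩ h (v'.1 0) := by
    simp only [v', pullJet_apply, map_smul, pull_pull_inv]
    simp
  have e1 : v.1 1 = (k : ℂ) • pull hk hΩ h (v'.1 1) := by
    simp only [v', pullJet_apply, map_smul, pull_pull_inv]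
    simp [smul_smul, hk']
  have e2 : v.1 2 = pull hk hΩ h (v'.1 2) := by
    simp only [v', pullJet_apply, map_smul, pull_pull_inv]
    simp
  have f0 : pullJet hk hΩ h w.1 0 = pull hk hΩ h (w.1 0) := by simp [pullJet_apply]
  have f1 : pullJet hk hΩ h w.1 1 = (k : ℂ) • pull hk hΩ h (w.1 1) := by simp [pullJet_apply]
  have f2 : pullJet hk hΩ h w.1 2 = pull hk hΩ h (w.1 2) := by simp [pullJet_apply]
  simp only [helmholtzForm]
  rw [f0, f1, f2, e0, e1, e2, ← pull_one hk hΩ hfin hfin' h, inner_smul_left, inner_smul_right]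
  simp only [inner_pull, Complex.conj_ofReal]
  rw [← hw v']
  ring

lemma isOpen_disk (b : ℝ) : IsOpen (disk b) :=
  isOpen_lt (by fun_prop) continuous_const

lemma isOpen_ellipse (a b : ℝ) : IsOpen (ellipse a b) :=
  isOpen_lt (by fun_prop) continuous_const

lemma ellipse_eq_preimage {a b : ℝ} (ha : 0 < a) (hb : 0 < b) :
    ellipse a b = stretch (b / a) ⁻¹' disk b := by
  ext p
  simp only [ellipse, disk, mem_ofPred_eq, mem_preimage, stretch_apply]
  rw [← mul_lt_mul_iff_right₀ (sq_pos_of_pos hb), mul_one]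
  have : b ^ 2 * (p.1 ^ 2 / a ^ 2 + p.2 ^ 2 / b ^ 2) = (b / a * p.1) ^ 2 + p.2 ^ 2 := by
    field_simp
  rw [this]

lemma mem_closedBall_of_mem_disk {b : ℝ} (hb : 0 < b) {p : ℝ × ℝ} (hp : p ∈ disk b) :
    p ∈ Metric.closedBall (0 : ℝ × ℝ) b := by
  have hp' : p.1 ^ 2 + p.2 ^ 2 < b ^ 2 := hp
  rw [mem_closedBall_zero_iff, Prod.norm_def, Real.norm_eq_abs, Real.norm_eq_abs]
  exact max_le (abs_le_of_sq_le_sq (by nlinarith [sq_nonneg p.2]) hb.le)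
    (abs_le_of_sq_le_sq (by nlinarith [sq_nonneg p.1]) hb.le)

lemma volume_disk_ne_top {b : ℝ} (hb : 0 < b) : volume (disk b) ≠ ⊤ :=
  (measure_mono (t := Metric.closedBall 0 b) fun _ hp => mem_closedBall_of_mem_disk hb hp).trans_lt
    measure_closedBall_lt_top |>.ne

/-- The Laplace transform of the heat content of the ellipse, as a mean over the disk. -/
lemma heatContentLaplace_ellipse {a b s : ℝ} (hb : 0 < b) (ha : 0 < a) (hs : 0 < s)
    {w : H10 (disk b)}
    (hw : ∀ v : H10 (disk b), ((b / a : ℝ) : ℂ) ^ 2 * ⟪v.1 1, w.1 1⟫_ℂ + ⟪v.1 2, w.1 2⟫_ℂ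
        + (s : ℂ) ^ 2 * ⟪v.1 0, w.1 0⟫_ℂ = ⟪v.1 0, one (disk b)⟫_ℂ) :
    IntegrableOn (fun t => Real.exp (-s ^ 2 * t) * heatContent (ellipse a b) t) (Ioi 0) ∧
      heatContentLaplace (ellipse a b) s = (mean (disk b) (w.1 0)).re := by
  have hk : 0 < b / a := by positivity
  have h := ellipse_eq_preimage ha hb
  have h' : disk b = stretch (b / a)⁻¹ ⁻¹' ellipse a b := by
    rw [h]
    ext p
    rw [mem_preimage, mem_preimage, stretch_stretch_inv hk]
  have hΩ := (isOpen_disk b).measurableSet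
  have hΩ' := (isOpen_ellipse a b).measurableSet
  have hfin := volume_disk_ne_top hb
  have hfin' : volume (ellipse a b) ≠ ⊤ := by
    rw [h, (measurePreserving_stretch hk).measure_preimage hΩ.nullMeasurableSet]
    exact ENNReal.mul_ne_top ENNReal.ofReal_ne_top hfin
  have key := heatContentLaplace_eq hfin' hs (helmholtzForm_pullJet hk hΩ hΩ' hfin hfin' h h' hw)
  refine ⟨key.1, key.2.trans ?_⟩
  rw [show (pullJet hk hΩ h w.1) 0 = pull hk hΩ h (w.1 0) by simp [pullJet_apply], mean_pull]

end HeatContent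

/-! ### Smooth functions vanishing on the circle, and integration by parts -/

namespace HeatContent

open Filter Topology

lemma exists_bound_disk {b : ℝ} (hb : 0 < b) {G : ℝ × ℝ → ℝ} (hG : Continuous G) :
    ∃ K, ∀ p ∈ disk b, |G p| ≤ K := by
  obtain ⟨K, hK⟩ := (isCompact_closedBall (0 : ℝ × ℝ) b).exists_bound_of_continuousOn
    hG.continuousOn
  exact ⟨K, fun p hp => hK p (mem_closedBall_of_mem_disk hb hp)⟩

lemma isFiniteMeasure_disk {b : ℝ} (hb : 0 < b) :
    IsFiniteMeasure (volume.restrict (disk b)) :=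
  isFiniteMeasure_restrict.2 (volume_disk_ne_top hb)

lemma memLp_disk {b : ℝ} (hb : 0 < b) {G : ℝ × ℝ → ℝ} (hG : Continuous G) :
    MemLp (fun p => (G p : ℂ)) 2 (volume.restrict (disk b)) := by
  have := isFiniteMeasure_disk hb
  obtain ⟨K, hK⟩ := exists_bound_disk hb hG
  refine MemLp.of_bound (Complex.continuous_ofReal.comp hG).aestronglyMeasurable K ?_
  refine ae_restrict_of_forall_mem (isOpen_disk b).measurableSet fun p hp => ?_
  rw [Complex.norm_real]
  exact hK p hp

/-- A continuous real function as an element of `L²` of the disk. -/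
noncomputable def toL2 {b : ℝ} (hb : 0 < b) {G : ℝ × ℝ → ℝ} (hG : Continuous G) : L2 (disk b) :=
  (memLp_disk hb hG).toLp

lemma toL2_ae_eq {b : ℝ} (hb : 0 < b) {G : ℝ × ℝ → ℝ} (hG : Continuous G) :
    toL2 hb hG =ᵐ[volume.restrict (disk b)] fun p => (G p : ℂ) :=
  MemLp.coeFn_toLp (memLp_disk hb hG)

/-- Vitali convergence on a finite measure space. Uniform integrability is immediate since no
function exceeds level `K + 1` on the disk. -/
lemma tendsto_toL2 {b : ℝ} (hb : 0 < b) {u : ℕ → ℝ × ℝ → ℝ} {v : ℝ × ℝ → ℝ}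
    (hu : ∀ n, Continuous (u n)) (hv : Continuous v) {K : ℝ}
    (hK : ∀ n, ∀ p ∈ disk b, |u n p| ≤ K) (hlim : ∀ p ∈ disk b, ∀ᶠ n in atTop, u n p = v p) :
    Tendsto (fun n => toL2 hb (hu n)) atTop (𝓝 (toL2 hb hv)) := by
  have := isFiniteMeasure_disk hb
  refine (Lp.tendsto_Lp_iff_tendsto_eLpNorm'' _ (fun n => memLp_disk hb (hu n)) _
    (memLp_disk hb hv)).2 ?_
  refine tendsto_Lp_finite_of_tendsto_ae (by norm_num) (by norm_num)
    (fun n => (memLp_disk hb (hu n)).1) (memLp_disk hb hv) ?_ ?_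
  · refine unifIntegrable_of (by norm_num) (by norm_num) (fun n => (memLp_disk hb (hu n)).1)
      fun ε _ => ⟨(K + 1).toNNReal, fun n => ?_⟩
    have h0 : {x | (K + 1).toNNReal ≤ ‖(u n x : ℂ)‖₊}.indicator (fun p => (u n p : ℂ))
        =ᵐ[volume.restrict (disk b)] 0 := by
      refine ae_restrict_of_forall_mem (isOpen_disk b).measurableSet fun p hp => ?_
      refine indicator_of_notMem (fun hmem => ?_) _
      have h1 : (K + 1).toNNReal ≤ ‖(u n p : ℂ)‖₊ := hmem
      rw [Real.toNNReal_le_iff_le_coe, coe_nnnorm, Complex.norm_real, Real.norm_eq_abs] at h1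
      linarith [hK n p hp]
    rw [eLpNorm_congr_ae h0]
    simp
  · refine ae_restrict_of_forall_mem (isOpen_disk b).measurableSet fun p hp => ?_
    exact tendsto_const_nhds.congr' ((hlim p hp).mono fun n hn => by simp [hn])

/-- The total derivative with partial derivatives `x` and `y`. -/
noncomputable def gradL (x y : ℝ) : ℝ × ℝ →L[ℝ] ℝ :=
  x • ContinuousLinearMap.fst ℝ ℝ ℝ + y • ContinuousLinearMap.snd ℝ ℝ ℝ

@[simp] lemma gradL_apply (x y : ℝ) (p : ℝ × ℝ) : gradL x y p = x * p.1 + y * p.2 := rfl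

/-- The triple `(G, Gx, Gy)`. -/
noncomputable def smoothJet {b : ℝ} (hb : 0 < b) {G Gx Gy : ℝ × ℝ → ℝ} (hG : Continuous G)
    (hx : Continuous Gx) (hy : Continuous Gy) : Jet (disk b) :=
  (PiLp.continuousLinearEquiv 2 ℂ (fun _ : Fin 3 => L2 (disk b))).symm
    ![toL2 hb hG, toL2 hb hx, toL2 hb hy]

section

variable {b : ℝ} (hb : 0 < b) {G Gx Gy : ℝ × ℝ → ℝ}

lemma fderiv_ofReal_comp {p : ℝ × ℝ} (hd : HasFDerivAt G (gradL (Gx p) (Gy p)) p) (v : ℝ × ℝ) :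
    fderiv ℝ (fun p => (G p : ℂ)) p v = ((Gx p * v.1 + Gy p * v.2 : ℝ) : ℂ) := by
  have h := (Complex.ofRealCLM.hasFDerivAt (x := G p)).comp p hd
  rw [show (fun p => (G p : ℂ)) = Complex.ofRealCLM ∘ G from rfl, h.fderiv]
  simp

lemma isJetOf_smoothJet (hG : Continuous G) (hx : Continuous Gx) (hy : Continuous Gy)
    (hd : ∀ p, HasFDerivAt G (gradL (Gx p) (Gy p)) p) :
    IsJetOf (disk b) (smoothJet hb hG hx hy) (fun p => (G p : ℂ)) := by
  refine ⟨toL2_ae_eq hb hG, (toL2_ae_eq hb hx).trans (Eventually.of_forall fun p => ?_),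
    (toL2_ae_eq hb hy).trans (Eventually.of_forall fun p => ?_)⟩ <;>
  · beta_reduce
    rw [fderiv_ofReal_comp (hd p)]
    simp

lemma tendsto_smoothJet {u ux uy : ℕ → ℝ × ℝ → ℝ} (hu : ∀ n, Continuous (u n))
    (hux : ∀ n, Continuous (ux n)) (huy : ∀ n, Continuous (uy n)) (hG : Continuous G)
    (hx : Continuous Gx) (hy : Continuous Gy) {K : ℝ}
    (hK : ∀ n, ∀ p ∈ disk b, |u n p| ≤ K ∧ |ux n p| ≤ K ∧ |uy n p| ≤ K)
    (hlim : ∀ p ∈ disk b, ∀ᶠ n in atTop, u n p = G p ∧ ux n p = Gx p ∧ uy n p = Gy p) :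
    Tendsto (fun n => smoothJet hb (hu n) (hux n) (huy n)) atTop (𝓝 (smoothJet hb hG hx hy)) := by
  refine ((PiLp.continuousLinearEquiv 2 ℂ
    (fun _ : Fin 3 => L2 (disk b))).symm.continuous.tendsto _).comp (tendsto_pi_nhds.2 fun i => ?_)
  fin_cases i
  · exact tendsto_toL2 hb hu hG (fun n p hp => (hK n p hp).1)
      fun p hp => (hlim p hp).mono fun n hn => hn.1
  · exact tendsto_toL2 hb hux hx (fun n p hp => (hK n p hp).2.1)
      fun p hp => (hlim p hp).mono fun n hn => hn.2.1
  · exact tendsto_toL2 hb huy hy (fun n p hp => (hK n p hp).2.2)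
      fun p hp => (hlim p hp).mono fun n hn => hn.2.2

lemma hasDerivAt_smoothTransition (x : ℝ) :
    HasDerivAt Real.smoothTransition (deriv Real.smoothTransition x) x :=
  ((Real.smoothTransition.contDiff (n := 1)).differentiable (by norm_num) x).hasDerivAt

lemma continuous_deriv_smoothTransition : Continuous (deriv Real.smoothTransition) :=
  (Real.smoothTransition.contDiff (n := 1)).continuous_deriv (by norm_num)

lemma deriv_smoothTransition_eq_zero {x : ℝ} (hx : 1 < x) : deriv Real.smoothTransition x = 0 := by
  have : Real.smoothTransition =ᶠ[𝓝 x] fun _ => 1 := by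
    filter_upwards [eventually_gt_nhds hx] with y hy
    exact Real.smoothTransition.one_of_one_le hy.le
  rw [this.deriv_eq, deriv_const]

/-- A smooth function that vanishes on the circle to first order belongs to `H¹₀` of the disk. -/
lemma smoothJet_mem_H10 (hGs : ContDiff ℝ ∞ G) (hx : Continuous Gx) (hy : Continuous Gy)
    (hd : ∀ p, HasFDerivAt G (gradL (Gx p) (Gy p)) p) {C : ℝ}
    (hC : ∀ p ∈ disk b, |G p| ≤ C * (b ^ 2 - (p.1 ^ 2 + p.2 ^ 2))) :
    smoothJet hb hGs.continuous hx hy ∈ H10 (disk b) := by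
  -- The cutoff `σ (z n)` vanishes where `b² - r² ≤ 1/n` and equals `1` where `b² - r² ≥ 2/n`. Hence
  -- the products are test functions and agree with `G`, together with their gradients, eventually
  -- at every point of the disk.
  let z : ℕ → ℝ × ℝ → ℝ := fun n p => n * (b ^ 2 - (p.1 ^ 2 + p.2 ^ 2)) - 1
  let σ := Real.smoothTransition
  let u : ℕ → ℝ × ℝ → ℝ := fun n p => σ (z n p) * G p
  let ux : ℕ → ℝ × ℝ → ℝ := fun n p => σ (z n p) * Gx p + deriv σ (z n p) * (n * (-2 * p.1)) * G p
  let uy : ℕ → ℝ × ℝ → ℝ := fun n p => σ (z n p) * Gy p + deriv σ (z n p) * (n * (-2 * p.2)) * G p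
  have hzc : ∀ n, Continuous (z n) := fun n => by fun_prop
  have hzs : ∀ n, ContDiff ℝ ∞ (z n) := fun n => by fun_prop
  have hGc := hGs.continuous
  have hus : ∀ n, ContDiff ℝ ∞ (u n) := fun n =>
    ((Real.smoothTransition.contDiff).comp (hzs n)).mul hGs
  have hσc : ∀ n, Continuous fun p => σ (z n p) := fun n =>
    Real.smoothTransition.continuous.comp (hzc n)
  have hσ'c : ∀ n, Continuous fun p => deriv σ (z n p) := fun n =>
    continuous_deriv_smoothTransition.comp (hzc n)
  have huxc : ∀ n, Continuous (ux n) := fun n => ((hσc n).mul hx).add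
    (((hσ'c n).mul (by fun_prop)).mul hGc)
  have huyc : ∀ n, Continuous (uy n) := fun n => ((hσc n).mul hy).add
    (((hσ'c n).mul (by fun_prop)).mul hGc)
  have hzd : ∀ n p, HasFDerivAt (z n) (gradL (n * (-2 * p.1)) (n * (-2 * p.2))) p := fun n p => by
    have h1 : HasFDerivAt (fun p : ℝ × ℝ => p.1) (ContinuousLinearMap.fst ℝ ℝ ℝ) p :=
      hasFDerivAt_fst
    have h2 : HasFDerivAt (fun p : ℝ × ℝ => p.2) (ContinuousLinearMap.snd ℝ ℝ ℝ) p :=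
      hasFDerivAt_snd
    refine HasFDerivAt.congr_fderiv ((((h1.pow 2).add (h2.pow 2)).const_sub (b ^ 2)).const_mul
      (n : ℝ) |>.sub_const 1) ?_
    ext <;> simp
  have hud : ∀ n p, HasFDerivAt (u n) (gradL (ux n p) (uy n p)) p := fun n p => by
    have h1 : HasFDerivAt (fun p => σ (z n p))
        (deriv σ (z n p) • gradL (n * (-2 * p.1)) (n * (-2 * p.2))) p :=
      (hasDerivAt_smoothTransition (z n p)).comp_hasFDerivAt p (hzd n p)
    refine (h1.mul (hd p)).congr_fderiv ?_
    ext <;> simp [ux, uy] <;> ring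
  have htest : ∀ n, IsTestFunction (disk b) (fun p => (u (n + 1) p : ℂ)) := fun n => by
    have hsub : tsupport (fun p => (u (n + 1) p : ℂ)) ⊆
        {p | 0 ≤ z (n + 1) p} := by
      refine closure_minimal (fun p hp => ?_) (isClosed_le continuous_const (hzc (n + 1)))
      by_contra hlt
      refine hp ?_
      simp only [u, σ]
      rw [Real.smoothTransition.zero_of_nonpos (not_le.1 hlt).le]
      simp
    have hsub' : {p | 0 ≤ z (n + 1) p} ⊆ disk b := fun p hp => by
      have h1 : 0 ≤ ((n + 1 : ℕ) : ℝ) * (b ^ 2 - (p.1 ^ 2 + p.2 ^ 2)) - 1 := hp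
      have h2 : (0 : ℝ) < ((n + 1 : ℕ) : ℝ) := by positivity
      show p.1 ^ 2 + p.2 ^ 2 < b ^ 2
      by_contra h3
      nlinarith
    refine ⟨Complex.ofRealCLM.contDiff.comp (hus (n + 1)), ?_, hsub.trans hsub'⟩
    exact HasCompactSupport.of_support_subset_isCompact (isCompact_closedBall (0 : ℝ × ℝ) b)
      ((subset_tsupport _).trans ((hsub.trans hsub').trans fun p hp => mem_closedBall_of_mem_disk hb hp))
  have hmem : ∀ n, smoothJet hb (hus (n + 1)).continuous (huxc (n + 1)) (huyc (n + 1))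
      ∈ H10 (disk b) := fun n =>
    (htest n).mem_H10 (isJetOf_smoothJet hb _ _ _ (hud (n + 1)))
  obtain ⟨K0, hK0⟩ := exists_bound_disk hb hGc
  obtain ⟨K1, hK1⟩ := exists_bound_disk hb hx
  obtain ⟨K2, hK2⟩ := exists_bound_disk hb hy
  obtain ⟨M, hM⟩ := (isCompact_Icc (a := (-1 : ℝ)) (b := 1)).exists_bound_of_continuousOn
    continuous_deriv_smoothTransition.continuousOn
  have hM0 : 0 ≤ M := (norm_nonneg _).trans (hM 0 (by norm_num))
  have hσ1 : ∀ t, |σ t| ≤ 1 := fun t => by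
    rw [abs_of_nonneg (Real.smoothTransition.nonneg t)]
    exact Real.smoothTransition.le_one t
  -- The derivative of the cutoff is of size `n`, but it is nonzero only where `b² - r² ≤ 2/n`.
  -- There the boundary bound gives `n |G| ≤ 2 |C|`, so the product stays bounded uniformly in `n`.
  have hcross : ∀ n, ∀ p ∈ disk b, ∀ c : ℝ, |c| ≤ b →
      |deriv σ (z n p) * (n * (-2 * c)) * G p| ≤ 4 * M * b * |C| := fun n p hp c hc => by
    have hq : 0 < b ^ 2 - (p.1 ^ 2 + p.2 ^ 2) := sub_pos.2 hp
    rcases lt_or_ge 1 (z n p) with h1 | h1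
    · rw [show deriv σ (z n p) = 0 from deriv_smoothTransition_eq_zero h1]
      simp only [zero_mul, abs_zero]
      positivity
    · have h2 : (n : ℝ) * (b ^ 2 - (p.1 ^ 2 + p.2 ^ 2)) ≤ 2 := by simp only [z] at h1; linarith
      have h3 : |deriv σ (z n p)| ≤ M := hM _ ⟨by
        have : 0 ≤ (n : ℝ) * (b ^ 2 - (p.1 ^ 2 + p.2 ^ 2)) := by positivity
        simp only [z]; linarith, h1⟩
      have h4 : (n : ℝ) * |G p| ≤ 2 * |C| := by
        have h5 : |G p| ≤ |C| * (b ^ 2 - (p.1 ^ 2 + p.2 ^ 2)) :=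
          (hC p hp).trans (mul_le_mul_of_nonneg_right (le_abs_self C) hq.le)
        calc (n : ℝ) * |G p| ≤ n * (|C| * (b ^ 2 - (p.1 ^ 2 + p.2 ^ 2))) := by gcongr
          _ = |C| * (n * (b ^ 2 - (p.1 ^ 2 + p.2 ^ 2))) := by ring
          _ ≤ |C| * 2 := by gcongr
          _ = 2 * |C| := by ring
      have h6 : |deriv σ (z n p) * (n * (-2 * c)) * G p|
          = |deriv σ (z n p)| * (2 * |c|) * (n * |G p|) := by
        rw [abs_mul, abs_mul, abs_mul, abs_mul]
        simp only [Nat.abs_cast, abs_neg, Nat.abs_ofNat]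
        ring
      rw [h6]
      calc |deriv σ (z n p)| * (2 * |c|) * (n * |G p|) ≤ M * (2 * b) * (2 * |C|) := by gcongr
        _ = 4 * M * b * |C| := by ring
  have hmain : ∀ n, ∀ p : ℝ × ℝ, ∀ t : ℝ, |σ (z n p) * t| ≤ |t| := fun n p t => by
    rw [abs_mul]
    exact mul_le_of_le_one_left (abs_nonneg t) (hσ1 _)
  have hcoord : ∀ p ∈ disk b, |p.1| ≤ b ∧ |p.2| ≤ b := fun p hp => by
    have := mem_closedBall_of_mem_disk hb hp
    rw [mem_closedBall_zero_iff, Prod.norm_def] at this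
    exact ⟨(le_max_left _ _).trans this, (le_max_right _ _).trans this⟩
  have hlim := tendsto_smoothJet hb (fun n => (hus (n + 1)).continuous) (fun n => huxc (n + 1))
    (fun n => huyc (n + 1)) hGc hx hy
    (K := max K0 (max (K1 + 4 * M * b * |C|) (K2 + 4 * M * b * |C|)))
    (fun n p hp => ⟨?_, ?_, ?_⟩) (fun p hp => ?_)
  · exact (Submodule.isClosed_topologicalClosure _).mem_of_tendsto hlim
      (Eventually.of_forall fun n => hmem n)
  · exact ((hmain _ p _).trans (hK0 p hp)).trans (le_max_left _ _)
  · refine (abs_add_le _ _).trans (le_trans ?_ ((le_max_left _ _).trans (le_max_right _ _)))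
    exact add_le_add ((hmain _ p _).trans (hK1 p hp)) (hcross _ p hp _ (hcoord p hp).1)
  · refine (abs_add_le _ _).trans (le_trans ?_ ((le_max_right _ _).trans (le_max_right _ _)))
    exact add_le_add ((hmain _ p _).trans (hK2 p hp)) (hcross _ p hp _ (hcoord p hp).2)
  · have hq : 0 < b ^ 2 - (p.1 ^ 2 + p.2 ^ 2) := sub_pos.2 hp
    have hev : ∀ᶠ n : ℕ in atTop, 2 < ((n + 1 : ℕ) : ℝ) * (b ^ 2 - (p.1 ^ 2 + p.2 ^ 2)) :=
      ((tendsto_natCast_atTop_atTop.comp (tendsto_add_atTop_nat 1)).atTop_mul_const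
        hq).eventually_gt_atTop 2
    filter_upwards [hev] with n hn
    have h1 : 1 < z (n + 1) p := by simp only [z]; linarith
    have h2 : σ (z (n + 1) p) = 1 := Real.smoothTransition.one_of_one_le h1.le
    have h3 : deriv σ (z (n + 1) p) = 0 := deriv_smoothTransition_eq_zero h1
    simp only [u, ux, uy, h2, h3]
    simp

/-- Integration by parts against an element of `H¹₀`, for one direction. -/
lemma inner_partial (i : Fin 3) (e : ℝ × ℝ)
    (hi : ∀ (f : ℝ × ℝ → ℂ) (w : Jet (disk b)), IsJetOf (disk b) w f →
      w i =ᵐ[volume.restrict (disk b)] fun p => fderiv ℝ f p e)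
    {G' : ℝ × ℝ → ℝ} (hG : Continuous G) (hG' : Continuous G')
    (hd : ∀ p, HasLineDerivAt ℝ G (G' p) p e) (v : H10 (disk b)) :
    ⟪v.1 i, toL2 hb hG⟫_ℂ = -⟪v.1 0, toL2 hb hG'⟫_ℂ := by
  -- The identity says that this bounded functional vanishes. Its kernel is closed, so test
  -- functions suffice, and for them the boundary term is absent.
  let ℓ : Jet (disk b) →L[ℂ] ℂ :=
    (innerSL ℂ (toL2 hb hG)).comp (PiLp.proj 2 (fun _ : Fin 3 => L2 (disk b)) i)
    + (innerSL ℂ (toL2 hb hG')).comp (PiLp.proj 2 (fun _ : Fin 3 => L2 (disk b)) 0)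
  have hℓ : ∀ w : Jet (disk b), ℓ w = ⟪toL2 hb hG, w i⟫_ℂ + ⟪toL2 hb hG', w 0⟫_ℂ :=
    fun w => rfl
  have key : H10 (disk b) ≤ LinearMap.ker ℓ.toLinearMap := by
    refine Submodule.topologicalClosure_minimal _ (Submodule.span_le.2 ?_) ℓ.isClosed_ker
    rintro w ⟨f, hf, hw⟩
    show ℓ w = 0
    have hint : ∀ (F : ℝ × ℝ → ℝ) (hF : Continuous F) (u : L2 (disk b)) (g : ℝ × ℝ → ℂ),
        u =ᵐ[volume.restrict (disk b)] g → (∀ p, p ∉ disk b → g p = 0) →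
        ⟪toL2 hb hF, u⟫_ℂ = ∫ p, (F p : ℂ) * g p := fun F hF u g hu hg => by
      rw [L2.inner_def, ← setIntegral_eq_integral_of_forall_compl_eq_zero
        (s := disk b) (f := fun p => (F p : ℂ) * g p) (fun p hp => by simp [hg p hp])]
      refine integral_congr_ae ?_
      filter_upwards [toL2_ae_eq hb hF, hu] with p h1 h2
      rw [h1, h2]
      simp [mul_comm]
    have hfc : Continuous f := hf.1.continuous
    have hf'c : Continuous fun p => fderiv ℝ f p e :=
      (hf.1.continuous_fderiv (by simp)).clm_apply continuous_const
    have hf's : HasCompactSupport fun p => fderiv ℝ f p e := hf.2.1.fderiv_apply ℝ e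
    have hout : ∀ p, p ∉ disk b → f p = 0 := fun p hp =>
      image_eq_zero_of_notMem_tsupport fun h => hp (hf.2.2 h)
    have hout' : ∀ p, p ∉ disk b → fderiv ℝ f p e = 0 := fun p hp => by
      rw [image_eq_zero_of_notMem_tsupport (f := fderiv ℝ f)
        fun h => hp (hf.2.2 (tsupport_fderiv_subset ℝ h))]
      rfl
    rw [hℓ, hint G hG _ _ (hi f w hw) hout', hint G' hG' _ _ hw.1 hout]
    have hGc : Continuous fun p => (G p : ℂ) := Complex.continuous_ofReal.comp hG
    have hG'c : Continuous fun p => (G' p : ℂ) := Complex.continuous_ofReal.comp hG'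
    have := integral_bilinear_hasLineDerivAt_right_eq_neg_left_of_integrable
      (μ := (volume : Measure (ℝ × ℝ))) (B := ContinuousLinearMap.mul ℝ ℂ)
      (f := fun p => (G p : ℂ)) (f' := fun p => (G' p : ℂ)) (g := f)
      (g' := fun p => fderiv ℝ f p e) (v := e)
      ((hG'c.mul hfc).integrable_of_hasCompactSupport hf.2.1.mul_left)
      ((hGc.mul hf'c).integrable_of_hasCompactSupport hf's.mul_left)
      ((hGc.mul hfc).integrable_of_hasCompactSupport hf.2.1.mul_left)
      (fun p _ => (hd p).ofReal_comp)
      (fun p _ => ((hf.1.differentiable (by simp) p).hasFDerivAt.hasLineDerivAt e))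
    simp only [ContinuousLinearMap.mul_apply'] at this
    rw [this]
    ring
  have h1 : ℓ v.1 = 0 := key v.2
  rw [hℓ, add_eq_zero_iff_eq_neg] at h1
  rw [← inner_conj_symm, h1, map_neg, inner_conj_symm]

end

end HeatContent

/-! ### Polar integrals over the disk -/

namespace HeatContent

open Real (cos sin)

/-- In polar coordinates the integrand separates. The product formula for integrals needs no
integrability, so `g` is arbitrary. -/
lemma integral_disk_pow_mul {b : ℝ} (hb : 0 < b) (n : ℕ) (g : ℝ → ℝ) :
    ∫ p in disk b, p.1 ^ n * g (p.1 ^ 2 + p.2 ^ 2)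
      = (∫ r in (0 : ℝ)..b, r ^ (n + 1) * g (r ^ 2)) * ∫ θ in (-Real.pi)..Real.pi, cos θ ^ n := by
  rw [← integral_indicator (isOpen_disk b).measurableSet, ← integral_comp_polarCoord_symm,
    polarCoord_target]
  have h1 : ∀ z ∈ Ioi (0 : ℝ) ×ˢ Ioo (-Real.pi) Real.pi,
      z.1 • (disk b).indicator (fun p : ℝ × ℝ => p.1 ^ n * g (p.1 ^ 2 + p.2 ^ 2))
        (polarCoord.symm z)
      = (Iio b).indicator (fun r => r ^ (n + 1) * g (r ^ 2)) z.1 * cos z.2 ^ n := by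
    rintro ⟨r, θ⟩ ⟨hr, -⟩
    have hr' : 0 < r := hr
    have hq : (r * cos θ) ^ 2 + (r * sin θ) ^ 2 = r ^ 2 := by
      linear_combination r ^ 2 * Real.sin_sq_add_cos_sq θ
    have hmem : (r * cos θ, r * sin θ) ∈ disk b ↔ r ∈ Iio b := by
      show (r * cos θ) ^ 2 + (r * sin θ) ^ 2 < b ^ 2 ↔ r < b
      rw [hq, sq_lt_sq₀ hr'.le hb.le]
    simp only [polarCoord_symm_apply, smul_eq_mul]
    by_cases h : r ∈ Iio b
    · rw [indicator_of_mem (hmem.2 h), indicator_of_mem h, hq]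
      ring
    · rw [indicator_of_notMem (fun h' => h (hmem.1 h')), indicator_of_notMem h]
      ring
  rw [setIntegral_congr_fun (measurableSet_Ioi.prod measurableSet_Ioo) h1, Measure.volume_eq_prod,
    setIntegral_prod_mul ((Iio b).indicator fun r => r ^ (n + 1) * g (r ^ 2))
      (fun θ => cos θ ^ n), setIntegral_indicator measurableSet_Iio, Ioi_inter_Iio,
    intervalIntegral.integral_of_le hb.le,
    intervalIntegral.integral_of_le (by linarith [Real.pi_pos]),
    integral_Ioc_eq_integral_Ioo, integral_Ioc_eq_integral_Ioo]

lemma integral_cos_pow_two_full : ∫ θ in (-Real.pi)..Real.pi, cos θ ^ 2 = Real.pi := by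
  rw [integral_cos_sq]; simp

lemma integral_cos_pow_four_full : ∫ θ in (-Real.pi)..Real.pi, cos θ ^ 4 = 3 / 4 * Real.pi := by
  rw [integral_cos_pow (n := 2), integral_cos_pow_two_full]; simp; ring

lemma integral_cos_pow_six_full : ∫ θ in (-Real.pi)..Real.pi, cos θ ^ 6 = 5 / 8 * Real.pi := by
  rw [integral_cos_pow (n := 4), integral_cos_pow_four_full]; simp; ring

lemma volume_disk_toReal {b : ℝ} (hb : 0 < b) : (volume (disk b)).toReal = Real.pi * b ^ 2 := by
  have h := integral_disk_pow_mul hb 0 fun _ => 1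
  simp only [pow_zero, mul_one, zero_add, pow_one, setIntegral_const, smul_eq_mul,
    integral_id, intervalIntegral.integral_const] at h
  rw [Measure.real] at h
  rw [h]
  ring

lemma integrableOn_disk {b : ℝ} (hb : 0 < b) {F : ℝ × ℝ → ℝ} (hF : Continuous F) :
    IntegrableOn F (disk b) :=
  (hF.continuousOn.integrableOn_compact (isCompact_closedBall (0 : ℝ × ℝ) b)).mono_set
    fun _ hp => mem_closedBall_of_mem_disk hb hp

/-- Integrals over the disk of even polynomials in `x` with radial coefficients. -/
lemma integral_disk_even {b κ : ℝ} (hb : 0 < b) (hκ : 0 < κ) {β₀ β₁ β₂ Φ : ℝ → ℝ}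
    (h₀ : Continuous β₀) (h₁ : Continuous β₁) (h₂ : Continuous β₂)
    -- The weights `1, 3/4, 5/8` are the integrals of `cos²`, `cos⁴`, `cos⁶` over a period divided
    -- by `π`. The substitution `t = κ r²` yields the prefactor `1/(2κ²)`.
    (hΦ : ∀ t, HasDerivAt Φ (t * β₀ t + 3 / 4 * t ^ 2 * β₁ t + 5 / 8 * t ^ 3 * β₂ t) t) :
    ∫ p in disk b, (p.1 ^ 2 * β₀ (κ * (p.1 ^ 2 + p.2 ^ 2))
        + p.1 ^ 4 * (κ * β₁ (κ * (p.1 ^ 2 + p.2 ^ 2)))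
        + p.1 ^ 6 * (κ ^ 2 * β₂ (κ * (p.1 ^ 2 + p.2 ^ 2))))
      = Real.pi / (2 * κ ^ 2) * (Φ (κ * b ^ 2) - Φ 0) := by
  rw [integral_add
      (integrableOn_disk hb (F := fun p => p.1 ^ 2 * β₀ (κ * (p.1 ^ 2 + p.2 ^ 2))
        + p.1 ^ 4 * (κ * β₁ (κ * (p.1 ^ 2 + p.2 ^ 2)))) (by fun_prop))
      (integrableOn_disk hb (F := fun p => p.1 ^ 6 * (κ ^ 2 * β₂ (κ * (p.1 ^ 2 + p.2 ^ 2))))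
        (by fun_prop)),
    integral_add
      (integrableOn_disk hb (F := fun p => p.1 ^ 2 * β₀ (κ * (p.1 ^ 2 + p.2 ^ 2))) (by fun_prop))
      (integrableOn_disk hb (F := fun p => p.1 ^ 4 * (κ * β₁ (κ * (p.1 ^ 2 + p.2 ^ 2))))
        (by fun_prop)),
    integral_disk_pow_mul hb 2 (fun q => β₀ (κ * q)),
    integral_disk_pow_mul hb 4 (fun q => κ * β₁ (κ * q)),
    integral_disk_pow_mul hb 6 (fun q => κ ^ 2 * β₂ (κ * q)),
    integral_cos_pow_two_full, integral_cos_pow_four_full, integral_cos_pow_six_full]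
  have hderiv : ∀ r : ℝ, HasDerivAt (fun r => Φ (κ * r ^ 2) / (2 * κ ^ 2))
      (r ^ (2 + 1) * β₀ (κ * r ^ 2) + 3 / 4 * (r ^ (4 + 1) * (κ * β₁ (κ * r ^ 2)))
        + 5 / 8 * (r ^ (6 + 1) * (κ ^ 2 * β₂ (κ * r ^ 2)))) r := fun r => by
    have h := ((hΦ (κ * r ^ 2)).comp r ((hasDerivAt_pow 2 r).const_mul κ)).div_const (2 * κ ^ 2)
    refine h.congr_deriv ?_
    field_simp
    push_cast
    ring
  have hint := intervalIntegral.integral_eq_sub_of_hasDerivAt (a := 0) (b := b)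
    (fun r _ => hderiv r) (Continuous.intervalIntegrable (by fun_prop) _ _)
  rw [intervalIntegral.integral_add (Continuous.intervalIntegrable (by fun_prop) _ _)
      (Continuous.intervalIntegrable (by fun_prop) _ _),
    intervalIntegral.integral_add (Continuous.intervalIntegrable (by fun_prop) _ _)
      (Continuous.intervalIntegrable (by fun_prop) _ _),
    intervalIntegral.integral_const_mul (3 / 4 : ℝ),
    intervalIntegral.integral_const_mul (5 / 8 : ℝ)] at hint
  have h0 : Φ (κ * 0 ^ 2) = Φ 0 := by simp
  rw [h0] at hint
  linear_combination Real.pi * hint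

lemma inner_toL2 {b : ℝ} (hb : 0 < b) {F G : ℝ × ℝ → ℝ} (hF : Continuous F) (hG : Continuous G) :
    ⟪toL2 hb hF, toL2 hb hG⟫_ℂ = ((∫ p in disk b, F p * G p : ℝ) : ℂ) := by
  rw [L2.inner_def, ← integral_complex_ofReal]
  refine integral_congr_ae ?_
  filter_upwards [toL2_ae_eq hb hF, toL2_ae_eq hb hG] with p h1 h2
  rw [h1, h2]
  simp [mul_comm]

end HeatContent

/-! ### Explicit solutions for the first two coefficients -/

namespace HeatContent

/-- Integrating by parts once in each direction shows that a classical solution in `H¹₀` is a weak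
one. -/
lemma helmholtzForm_smoothJet {b : ℝ} (hb : 0 < b) {s : ℝ} {G Gx Gy Gxx Gyy F : ℝ × ℝ → ℝ}
    (hG : Continuous G) (hx : Continuous Gx) (hy : Continuous Gy) (hxx : Continuous Gxx)
    (hyy : Continuous Gyy) (hF : Continuous F)
    (hdx : ∀ p, HasLineDerivAt ℝ Gx (Gxx p) p (1, 0))
    (hdy : ∀ p, HasLineDerivAt ℝ Gy (Gyy p) p (0, 1))
    (heq : ∀ p, s ^ 2 * G p - Gxx p - Gyy p = F p)
    (hmem : smoothJet hb hG hx hy ∈ H10 (disk b)) (v : H10 (disk b)) :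
    helmholtzForm s v ⟨smoothJet hb hG hx hy, hmem⟩ = ⟪v.1 0, toL2 hb hF⟫_ℂ := by
  have h : toL2 hb hF = ((s : ℂ) ^ 2) • toL2 hb hG - toL2 hb hxx - toL2 hb hyy := by
    refine Lp.ext ?_
    filter_upwards [toL2_ae_eq hb hF, toL2_ae_eq hb hG, toL2_ae_eq hb hxx, toL2_ae_eq hb hyy,
      Lp.coeFn_sub (((s : ℂ) ^ 2) • toL2 hb hG - toL2 hb hxx) (toL2 hb hyy),
      Lp.coeFn_sub (((s : ℂ) ^ 2) • toL2 hb hG) (toL2 hb hxx),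
      Lp.coeFn_smul ((s : ℂ) ^ 2) (toL2 hb hG)] with p e1 e2 e3 e4 e5 e6 e7
    rw [e1, e5, Pi.sub_apply, e6, Pi.sub_apply, e7, Pi.smul_apply, e2, e3, e4, ← heq p]
    push_cast
    rfl
  have h1 := inner_partial hb 1 (1, 0) (fun f w hw => hw.2.1) hx hxx hdx v
  have h2 := inner_partial hb 2 (0, 1) (fun f w hw => hw.2.2) hy hyy hdy v
  rw [h, inner_sub_right, inner_sub_right, inner_smul_right]
  have e : helmholtzForm s v ⟨smoothJet hb hG hx hy, hmem⟩
    = ⟪v.1 1, toL2 hb hx⟫_ℂ + ⟪v.1 2, toL2 hb hy⟫_ℂ + (s : ℂ) ^ 2 * ⟪v.1 0, toL2 hb hG⟫_ℂ := rfl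
  rw [e, h1, h2]
  ring

lemma toL2_one {b : ℝ} (hb : 0 < b) :
    toL2 hb (continuous_const (y := (1 : ℝ))) = one (disk b) := by
  refine Lp.ext ?_
  filter_upwards [toL2_ae_eq hb (continuous_const (y := (1 : ℝ))),
    one_ae_eq (volume_disk_ne_top hb)] with p h1 h2
  rw [h1, h2, Complex.ofReal_one]

lemma toL2_neg {b : ℝ} (hb : 0 < b) {F : ℝ × ℝ → ℝ} (hF : Continuous F) :
    toL2 hb hF.neg = -toL2 hb hF := by
  refine Lp.ext ?_
  filter_upwards [toL2_ae_eq hb hF.neg, toL2_ae_eq hb hF, Lp.coeFn_neg (toL2 hb hF)]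
    with p h1 h2 h3
  rw [h1, h3, Pi.neg_apply, Pi.neg_apply, h2, Complex.ofReal_neg]

lemma exists_bound_of_vanishing {T : ℝ} (hT : 0 ≤ T) {g : ℝ → ℝ} (hg : ContDiff ℝ ∞ g)
    (h0 : g T = 0) : ∃ C, 0 ≤ C ∧ ∀ t ∈ Icc 0 T, |g t| ≤ C * (T - t) := by
  obtain ⟨C, hC⟩ := (isCompact_Icc (a := 0) (b := T)).exists_bound_of_continuousOn
    (hg.continuous_deriv (by simp)).continuousOn
  refine ⟨C, (norm_nonneg _).trans (hC T (right_mem_Icc.2 hT)), fun t ht => ?_⟩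
  have := (convex_Icc 0 T).norm_image_sub_le_of_norm_deriv_le
    (fun x _ => hg.differentiable (by simp) x) hC (right_mem_Icc.2 hT) ht
  rw [h0, sub_zero, Real.norm_eq_abs, Real.norm_eq_abs, abs_sub_comm,
    abs_of_nonneg (sub_nonneg.2 ht.2)] at this
  exact this

/-- A bound `C (b² - r²)` on the disk for functions `x² α(r²) + β(r²)` that vanish on the circle. -/
lemma exists_bound_radial {b κ : ℝ} (hκ : 0 < κ) {α β : ℝ → ℝ} (hα : ContDiff ℝ ∞ α)
    (hβ : ContDiff ℝ ∞ β) (hα0 : α (κ * b ^ 2) = 0) (hβ0 : β (κ * b ^ 2) = 0) :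
    ∃ C, ∀ p ∈ disk b, |p.1 ^ 2 * α (κ * (p.1 ^ 2 + p.2 ^ 2)) + β (κ * (p.1 ^ 2 + p.2 ^ 2))|
      ≤ C * (b ^ 2 - (p.1 ^ 2 + p.2 ^ 2)) := by
  obtain ⟨C₁, h₁, hC₁⟩ := exists_bound_of_vanishing (by positivity) hα hα0
  obtain ⟨C₂, h₂, hC₂⟩ := exists_bound_of_vanishing (by positivity) hβ hβ0
  refine ⟨b ^ 2 * (C₁ * κ) + C₂ * κ, fun p hp => ?_⟩
  have hp' : p.1 ^ 2 + p.2 ^ 2 < b ^ 2 := hp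
  have ht : κ * (p.1 ^ 2 + p.2 ^ 2) ∈ Icc 0 (κ * b ^ 2) :=
    ⟨by positivity, mul_le_mul_of_nonneg_left hp'.le hκ.le⟩
  have hx : p.1 ^ 2 ≤ b ^ 2 := by nlinarith [sq_nonneg p.2]
  refine (abs_add_le _ _).trans ?_
  rw [abs_mul, abs_of_nonneg (sq_nonneg p.1)]
  calc p.1 ^ 2 * |α (κ * (p.1 ^ 2 + p.2 ^ 2))| + |β (κ * (p.1 ^ 2 + p.2 ^ 2))|
      ≤ b ^ 2 * (C₁ * (κ * b ^ 2 - κ * (p.1 ^ 2 + p.2 ^ 2)))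
        + C₂ * (κ * b ^ 2 - κ * (p.1 ^ 2 + p.2 ^ 2)) :=
        add_le_add (mul_le_mul hx (hC₁ _ ht) (abs_nonneg _) (sq_nonneg b)) (hC₂ _ ht)
    _ = _ := by ring

/-- The functions `E_n(κ (x² + y²))` of the plane. -/
noncomputable def planeE (κ : ℝ) (n : ℕ) (p : ℝ × ℝ) : ℝ := besselE n (κ * (p.1 ^ 2 + p.2 ^ 2))

lemma contDiff_planeE (κ : ℝ) (n : ℕ) : ContDiff ℝ ∞ (planeE κ n) :=
  (contDiff_besselE n).comp (by fun_prop)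

@[fun_prop] lemma continuous_planeE (κ : ℝ) (n : ℕ) : Continuous (planeE κ n) :=
  (contDiff_planeE κ n).continuous

lemma hasFDerivAt_planeE (κ : ℝ) (n : ℕ) (p : ℝ × ℝ) :
    HasFDerivAt (planeE κ n) (gradL (2 * κ * p.1 * planeE κ (n + 1) p)
      (2 * κ * p.2 * planeE κ (n + 1) p)) p := by
  have h1 : HasFDerivAt (fun p : ℝ × ℝ => p.1) (ContinuousLinearMap.fst ℝ ℝ ℝ) p := hasFDerivAt_fst
  have h2 : HasFDerivAt (fun p : ℝ × ℝ => p.2) (ContinuousLinearMap.snd ℝ ℝ ℝ) p := hasFDerivAt_snd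
  refine ((hasDerivAt_besselE n _).comp_hasFDerivAt p
    (((h1.pow 2).add (h2.pow 2)).const_mul κ)).congr_fderiv ?_
  ext <;> simp [planeE] <;> ring

lemma planeE_recurrence (κ : ℝ) (n : ℕ) (p : ℝ × ℝ) :
    planeE κ n p = (n + 1) * planeE κ (n + 1) p
      + κ * (p.1 ^ 2 + p.2 ^ 2) * planeE κ (n + 2) p :=
  besselE_recurrence n _

lemma continuous_besselE (n : ℕ) : Continuous (besselE n) := (contDiff_besselE n).continuous

/-- On functions of `t = κ r²`, `Δ - s²` acts as `4κ (t f'' + f' - f)`, and the recurrence at `n =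
0` says that `E₀` is annihilated. Add a multiple of it to the constant `1/s²` to meet the boundary
condition. -/
lemma exists_first_coefficient {b s κ I : ℝ} (hb : 0 < b) (hs : 0 < s) (hκ : s ^ 2 = 4 * κ)
    (hI : I = besselE 0 (κ * b ^ 2)) :
    ∃ (G Gx Gxx : ℝ × ℝ → ℝ) (hG : Continuous G) (hx : Continuous Gx) (w : H10 (disk b)),
      Continuous Gxx ∧ (∀ p, G p = 1 / s ^ 2 * (1 - 1 / I * planeE κ 0 p)) ∧
      (∀ p, Gx p = -(p.1 / (2 * I)) * planeE κ 1 p) ∧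
      (∀ p, Gxx p = -(1 / (2 * I)) * (planeE κ 1 p + 2 * κ * p.1 ^ 2 * planeE κ 2 p)) ∧
      (∀ p, HasLineDerivAt ℝ Gx (Gxx p) p (1, 0)) ∧ w.1 0 = toL2 hb hG ∧ w.1 1 = toL2 hb hx ∧
      ∀ v : H10 (disk b), helmholtzForm s v w = ⟪v.1 0, one (disk b)⟫_ℂ := by
  have hκ0 : 0 < κ := by nlinarith [sq_pos_of_pos hs]
  have hI0 : I ≠ 0 := by rw [hI]; exact (besselE_pos 0 (by positivity)).ne'
  have h1 : ∀ p : ℝ × ℝ, HasFDerivAt (fun p : ℝ × ℝ => p.1) (ContinuousLinearMap.fst ℝ ℝ ℝ) p :=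
    fun p => hasFDerivAt_fst
  have h2 : ∀ p : ℝ × ℝ, HasFDerivAt (fun p : ℝ × ℝ => p.2) (ContinuousLinearMap.snd ℝ ℝ ℝ) p :=
    fun p => hasFDerivAt_snd
  let G : ℝ × ℝ → ℝ := fun p => 1 / s ^ 2 * (1 - 1 / I * planeE κ 0 p)
  let Gx : ℝ × ℝ → ℝ := fun p => -(1 / (2 * I)) * (p.1 * planeE κ 1 p)
  let Gy : ℝ × ℝ → ℝ := fun p => -(1 / (2 * I)) * (p.2 * planeE κ 1 p)
  let Gxx : ℝ × ℝ → ℝ := fun p =>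
    -(1 / (2 * I)) * (planeE κ 1 p + 2 * κ * p.1 ^ 2 * planeE κ 2 p)
  let Gyy : ℝ × ℝ → ℝ := fun p =>
    -(1 / (2 * I)) * (planeE κ 1 p + 2 * κ * p.2 ^ 2 * planeE κ 2 p)
  have hGs : ContDiff ℝ ∞ G :=
    contDiff_const.mul (contDiff_const.sub (contDiff_const.mul (contDiff_planeE κ 0)))
  have hx : Continuous Gx := by fun_prop
  have hy : Continuous Gy := by fun_prop
  have hxx : Continuous Gxx := by fun_prop
  have hyy : Continuous Gyy := by fun_prop
  have hd : ∀ p, HasFDerivAt G (gradL (Gx p) (Gy p)) p := fun p => by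
    refine ((((hasFDerivAt_planeE κ 0 p).const_mul (1 / I)).const_sub 1).const_mul
      (1 / s ^ 2)).congr_fderiv ?_
    rw [hκ]
    ext <;> simp [Gx, Gy] <;> field_simp <;> ring
  have hdx : ∀ p, HasLineDerivAt ℝ Gx (Gxx p) p (1, 0) := fun p => by
    have h := (((h1 p).mul (hasFDerivAt_planeE κ 1 p)).const_mul (-(1 / (2 * I)))).hasLineDerivAt
      (1, 0)
    convert! h using 1
    simp [Gxx]
    ring
  have hdy : ∀ p, HasLineDerivAt ℝ Gy (Gyy p) p (0, 1) := fun p => by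
    have h := (((h2 p).mul (hasFDerivAt_planeE κ 1 p)).const_mul (-(1 / (2 * I)))).hasLineDerivAt
      (0, 1)
    convert! h using 1
    simp [Gyy]
    ring
  have hg : ContDiff ℝ ∞ fun t => 1 / s ^ 2 * (1 - 1 / I * besselE 0 t) :=
    contDiff_const.mul (contDiff_const.sub (contDiff_const.mul (contDiff_besselE 0)))
  obtain ⟨C, hC⟩ := exists_bound_radial hκ0 (contDiff_const (c := (0 : ℝ))) hg rfl
    (by rw [← hI]; field_simp; ring) (b := b)
  have hmem := smoothJet_mem_H10 hb hGs hx hy hd (C := C)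
    fun p hp => by simpa [G, planeE] using hC p hp
  refine ⟨G, Gx, Gxx, hGs.continuous, hx, ⟨_, hmem⟩, hxx, fun p => rfl, fun p => ?_, fun p => rfl,
    hdx, rfl, rfl, fun v => ?_⟩
  · simp only [Gx]; ring
  · rw [← toL2_one hb]
    refine helmholtzForm_smoothJet hb hGs.continuous hx hy hxx hyy _ hdx hdy (fun p => ?_) hmem v
    have hr := planeE_recurrence κ 0 p
    simp only [G, Gxx, Gyy]
    rw [hr]
    field_simp
    push_cast
    ring

/-- The right side contains the angular modes `1` and `cos 2θ`. With `c = -1/(2I)`, a particular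
solution is `c/(4κ) · 2κ x² E₁`; the homogeneous solutions are `E₀` and `κ (x² - y²) E₂ = 2κ x² E₂ -
t E₂`. On the circle, `B` cancels the coefficient of `x²` and then `A` cancels the radial remainder.
-/
lemma exists_second_coefficient {b s κ I A B : ℝ} (hb : 0 < b) (hs : 0 < s) (hκ : s ^ 2 = 4 * κ)
    (hI : I = besselE 0 (κ * b ^ 2)) (hA : A = κ * b ^ 2 * besselE 1 (κ * b ^ 2) / I)
    (hB : B = besselE 1 (κ * b ^ 2) / besselE 2 (κ * b ^ 2)) {F : ℝ × ℝ → ℝ} (hF : Continuous F)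
    (hFeq : ∀ p, F p = 1 / (2 * I) * (planeE κ 1 p + 2 * κ * p.1 ^ 2 * planeE κ 2 p)) :
    ∃ (Gx : ℝ × ℝ → ℝ) (hx : Continuous Gx) (w : H10 (disk b)),
      (∀ p, Gx p = -(p.1 / (2 * I)) * ((1 - A / 2) * planeE κ 1 p - B / 2 * planeE κ 2 p
        + B / 2 * (κ * (p.1 ^ 2 + p.2 ^ 2)) * planeE κ 3 p
        + κ * p.1 ^ 2 * (planeE κ 2 p - B * planeE κ 3 p))) ∧
      w.1 1 = toL2 hb hx ∧ ∀ v : H10 (disk b), helmholtzForm s v w = ⟪v.1 0, toL2 hb hF⟫_ℂ := by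
  have hκ0 : 0 < κ := by nlinarith [sq_pos_of_pos hs]
  have hI0 : I ≠ 0 := by rw [hI]; exact (besselE_pos 0 (by positivity)).ne'
  have hE2 : besselE 2 (κ * b ^ 2) ≠ 0 := (besselE_pos 2 (by positivity)).ne'
  have h1 : ∀ p : ℝ × ℝ, HasFDerivAt (fun p : ℝ × ℝ => p.1) (ContinuousLinearMap.fst ℝ ℝ ℝ) p :=
    fun p => hasFDerivAt_fst
  have h2 : ∀ p : ℝ × ℝ, HasFDerivAt (fun p : ℝ × ℝ => p.2) (ContinuousLinearMap.snd ℝ ℝ ℝ) p :=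
    fun p => hasFDerivAt_snd
  have hE := hasFDerivAt_planeE κ
  have hq : ∀ p : ℝ × ℝ, HasFDerivAt (fun p : ℝ × ℝ => κ * (p.1 ^ 2 + p.2 ^ 2))
      (gradL (2 * κ * p.1) (2 * κ * p.2)) p := fun p => by
    refine ((((h1 p).pow 2).add ((h2 p).pow 2)).const_mul κ).congr_fderiv ?_
    ext <;> simp <;> ring
  let c : ℝ := -(1 / (2 * I))
  let G : ℝ × ℝ → ℝ := fun p => c / (4 * κ) * (2 * κ * (p.1 ^ 2 * (planeE κ 1 p - B * planeE κ 2 p))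
    + (B * (κ * (p.1 ^ 2 + p.2 ^ 2) * planeE κ 2 p) - A * planeE κ 0 p))
  let Gx : ℝ × ℝ → ℝ := fun p => c * (p.1 * ((1 - A / 2) * planeE κ 1 p - B / 2 * planeE κ 2 p
        + B / 2 * (κ * (p.1 ^ 2 + p.2 ^ 2) * planeE κ 3 p)
        + κ * (p.1 ^ 2 * (planeE κ 2 p - B * planeE κ 3 p))))
  let Gy : ℝ × ℝ → ℝ := fun p => c * (p.2 * (κ * (p.1 ^ 2 * (planeE κ 2 p - B * planeE κ 3 p))
    + B / 2 * (planeE κ 2 p + κ * (p.1 ^ 2 + p.2 ^ 2) * planeE κ 3 p) - A / 2 * planeE κ 1 p))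
  let Gxx : ℝ × ℝ → ℝ := fun p => c * ((1 - A / 2) * planeE κ 1 p - B / 2 * planeE κ 2 p
    + B / 2 * (κ * (p.1 ^ 2 + p.2 ^ 2) * planeE κ 3 p)
    + 2 * κ * p.1 ^ 2 * ((1 - A / 2) * planeE κ 2 p
      + B / 2 * (κ * (p.1 ^ 2 + p.2 ^ 2) * planeE κ 4 p))
    + 3 * κ * p.1 ^ 2 * (planeE κ 2 p - B * planeE κ 3 p)
    + 2 * κ ^ 2 * p.1 ^ 4 * (planeE κ 3 p - B * planeE κ 4 p))
  let Gyy : ℝ × ℝ → ℝ := fun p => c * (κ * (p.1 ^ 2 * (planeE κ 2 p - B * planeE κ 3 p))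
    + B / 2 * (planeE κ 2 p + κ * (p.1 ^ 2 + p.2 ^ 2) * planeE κ 3 p) - A / 2 * planeE κ 1 p
    + 2 * κ * p.2 ^ 2 * (κ * (p.1 ^ 2 * (planeE κ 3 p - B * planeE κ 4 p))
      + B / 2 * (2 * planeE κ 3 p + κ * (p.1 ^ 2 + p.2 ^ 2) * planeE κ 4 p)
      - A / 2 * planeE κ 2 p))
  have hGs : ContDiff ℝ ∞ G := by
    have e0 := contDiff_planeE κ 0
    have e1 := contDiff_planeE κ 1
    have e2 := contDiff_planeE κ 2
    fun_prop
  have hx : Continuous Gx := by fun_prop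
  have hy : Continuous Gy := by fun_prop
  have hxx : Continuous Gxx := by fun_prop
  have hyy : Continuous Gyy := by fun_prop
  have hd : ∀ p, HasFDerivAt G (gradL (Gx p) (Gy p)) p := fun p => by
    refine ((((((h1 p).pow 2).mul ((hE 1 p).sub ((hE 2 p).const_mul B))).const_mul (2 * κ)).add
      ((((hq p).mul (hE 2 p)).const_mul B).sub ((hE 0 p).const_mul A))).const_mul
      (c / (4 * κ))).congr_fderiv ?_
    ext <;> simp [Gx, Gy] <;> field_simp <;> ring
  have hdx : ∀ p, HasLineDerivAt ℝ Gx (Gxx p) p (1, 0) := fun p => by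
    have h := (((h1 p).mul (((((hE 1 p).const_mul (1 - A / 2)).sub ((hE 2 p).const_mul (B / 2))).add
      (((hq p).mul (hE 3 p)).const_mul (B / 2))).add ((((h1 p).pow 2).mul
      ((hE 2 p).sub ((hE 3 p).const_mul B))).const_mul κ))).const_mul c).hasLineDerivAt (1, 0)
    convert! h using 1
    simp [Gxx]
    ring
  have hdy : ∀ p, HasLineDerivAt ℝ Gy (Gyy p) p (0, 1) := fun p => by
    have h := (((h2 p).mul ((((((h1 p).pow 2).mul
      ((hE 2 p).sub ((hE 3 p).const_mul B))).const_mul κ).add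
      (((hE 2 p).add ((hq p).mul (hE 3 p))).const_mul (B / 2))).sub
      ((hE 1 p).const_mul (A / 2)))).const_mul c).hasLineDerivAt (0, 1)
    convert! h using 1
    simp [Gyy]
    ring
  have hα : ContDiff ℝ ∞ fun t => c / 2 * (besselE 1 t - B * besselE 2 t) :=
    contDiff_const.mul ((contDiff_besselE 1).sub (contDiff_const.mul (contDiff_besselE 2)))
  have hβ : ContDiff ℝ ∞ fun t => c / (4 * κ) * (B * (t * besselE 2 t) - A * besselE 0 t) :=
    contDiff_const.mul ((contDiff_const.mul (contDiff_id.mul (contDiff_besselE 2))).sub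
      (contDiff_const.mul (contDiff_besselE 0)))
  obtain ⟨C, hC⟩ := exists_bound_radial hκ0 hα hβ (b := b)
    (by rw [hB, div_mul_cancel₀ _ hE2]; ring)
    (by rw [hA, ← hI, hB]; field_simp; ring)
  have hmem := smoothJet_mem_H10 hb hGs hx hy hd (C := C) fun p hp => by
    refine le_trans (le_of_eq ?_) (hC p hp)
    congr 1
    simp only [G, planeE]
    field_simp
    ring
  refine ⟨Gx, hx, ⟨_, hmem⟩, fun p => ?_, rfl, fun v => ?_⟩
  · simp only [Gx, c]; ring
  · refine helmholtzForm_smoothJet hb hGs.continuous hx hy hxx hyy _ hdx hdy (fun p => ?_) hmem v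
    have hr0 := planeE_recurrence κ 0 p
    have hr1 := planeE_recurrence κ 1 p
    have hr2 := planeE_recurrence κ 2 p
    rw [hFeq p, hκ]
    simp only [G, Gxx, Gyy, c]
    norm_num at hr0 hr1 hr2
    rw [hr0, hr1, hr2]
    field_simp
    ring

end HeatContent

/-! ### Means of the coefficients -/

namespace HeatContent

lemma IsLocalExpansion.mean_eq {b s : ℝ} (hb : 0 < b) {h : ℕ → H10 (disk b)}
    (hh : IsLocalExpansion b s h) (i j : ℕ) :
    mean (disk b) ((h (i + j)).1 0)
      = (((Real.pi * b ^ 2)⁻¹ : ℝ) : ℂ) * helmholtzForm s (h i) (h j) := by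
  rw [mean, ← inner_one_eq (volume_disk_ne_top hb), hh.inner_one, volume_disk_toReal hb]

lemma IsLocalExpansion.mean_real {b s : ℝ} (hb : 0 < b) {h : ℕ → H10 (disk b)}
    (hh : IsLocalExpansion b s h) (j : ℕ) :
    mean (disk b) ((h j).1 0) = ((mean (disk b) ((h j).1 0)).re : ℂ) := by
  refine (Complex.conj_eq_iff_re.1 ?_).symm
  have e := hh.mean_eq hb 0 j
  rw [zero_add] at e
  rw [e, map_mul, Complex.conj_ofReal, helmholtzForm_conj, hh.form_eq 0 j, zero_add]

lemma IsLocalExpansion.hasSum_heatContentLaplace {a b s ε : ℝ} (hb : 0 < b) (hs : 0 < s)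
    (hab : b ≤ a) (hε : ε = Real.sqrt (1 - (b / a) ^ 2)) {h : ℕ → H10 (disk b)}
    (hh : IsLocalExpansion b s h) :
    IntegrableOn (fun t => Real.exp (-s ^ 2 * t) * heatContent (ellipse a b) t) (Ioi 0) ∧
      HasSum (fun j => (mean (disk b) ((h j).1 0)).re * ε ^ (2 * j))
        (heatContentLaplace (ellipse a b) s) := by
  have ha : 0 < a := hb.trans_le hab
  have hk : 0 < b / a := by positivity
  have hk1 : b / a ≤ 1 := (div_le_one ha).2 hab
  have hl0 : 0 ≤ 1 - (b / a) ^ 2 := by nlinarith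
  have hl1 : 1 - (b / a) ^ 2 < 1 := by nlinarith
  obtain ⟨w, hw, hform⟩ := hh.hasSum hs hl0 hl1
  have key := heatContentLaplace_ellipse hb ha hs (w := w) fun v => by
    rw [← hform v]
    push_cast
    ring
  refine ⟨key.1, ?_⟩
  rw [key.2]
  have h1 := Complex.hasSum_re (hw.mapL ((meanL (disk b)).comp (H10.comp (disk b) 0)))
  have hfin := volume_disk_ne_top hb
  rw [ContinuousLinearMap.comp_apply, H10.comp_apply, ← mean_eq_meanL hfin] at h1
  refine h1.congr_fun fun j => ?_
  rw [map_smul, ContinuousLinearMap.comp_apply, H10.comp_apply, ← mean_eq_meanL hfin, smul_eq_mul,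
    ← Complex.ofReal_pow, Complex.re_ofReal_mul, pow_mul, hε, Real.sq_sqrt hl0, mul_comm]

lemma integral_disk_besselE {b : ℝ} (hb : 0 < b) (κ : ℝ) :
    ∫ p in disk b, planeE κ 0 p = Real.pi * b ^ 2 * besselE 1 (κ * b ^ 2) := by
  have h := integral_disk_pow_mul hb 0 fun q => besselE 0 (κ * q)
  simp only [pow_zero, one_mul, zero_add, pow_one, intervalIntegral.integral_const] at h
  have hderiv : ∀ r : ℝ, HasDerivAt (fun r => r ^ 2 / 2 * besselE 1 (κ * r ^ 2))
      (r * besselE 0 (κ * r ^ 2)) r := fun r => by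
    have h1 := ((hasDerivAt_pow 2 r).div_const 2).mul ((hasDerivAt_besselE 1 (κ * r ^ 2)).comp r
      ((hasDerivAt_pow 2 r).const_mul κ))
    refine h1.congr_deriv ?_
    rw [besselE_recurrence 0]
    simp
    ring
  have hc := continuous_besselE 0
  have hint := intervalIntegral.integral_eq_sub_of_hasDerivAt (a := 0) (b := b)
    (fun r _ => hderiv r) (Continuous.intervalIntegrable (by fun_prop) _ _)
  rw [show (∫ p in disk b, planeE κ 0 p) = _ from h, hint]
  simp
  ring

/-- Since `E₁' = E₂` and `t E₂' = E₁ - 2 E₂`, differentiation preserves combinations of `tᵐ E₁²`,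
`tᵐ E₁ E₂`, `tᵐ E₂²`. A primitive can thus be sought by undetermined coefficients; the same method
underlies the next two lemmas. -/
lemma hasDerivAt_primitive_one (t : ℝ) : HasDerivAt
    (fun t => t ^ 2 * besselE 1 t ^ 2 - t ^ 2 * besselE 1 t * besselE 2 t - t ^ 3 * besselE 2 t ^ 2)
    (t * besselE 1 t ^ 2) t := by
  have h1 := hasDerivAt_besselE 1 t
  have h2 := hasDerivAt_besselE 2 t
  refine ((((hasDerivAt_pow 2 t).mul (h1.pow 2)).sub (((hasDerivAt_pow 2 t).mul h1).mul h2)).sub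
    ((hasDerivAt_pow 3 t).mul (h2.pow 2))).congr_deriv ?_
  have hr := besselE_recurrence 1 t
  norm_num at hr ⊢
  rw [hr]
  ring

lemma hasDerivAt_primitive_two (A B t : ℝ) : HasDerivAt
    (fun t => 5 / 8 * (t ^ 2 * besselE 1 t ^ 2) - 1 / 4 * (t ^ 2 * besselE 1 t * besselE 2 t)
      - 1 / 4 * (t ^ 3 * besselE 2 t ^ 2)
      - (A / 2 + B / 4) * (t ^ 2 * besselE 1 t ^ 2 - t ^ 2 * besselE 1 t * besselE 2 t
        - t ^ 3 * besselE 2 t ^ 2))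
    (t * (((1 - A / 2) * besselE 1 t - B / 2 * besselE 2 t + B / 2 * t * besselE 3 t) * besselE 1 t)
      + 3 / 4 * t ^ 2 * ((besselE 2 t - B * besselE 3 t) * besselE 1 t)) t := by
  have h1 := hasDerivAt_besselE 1 t
  have h2 := hasDerivAt_besselE 2 t
  have m1 := (hasDerivAt_pow 2 t).mul (h1.pow 2)
  have m2 := ((hasDerivAt_pow 2 t).mul h1).mul h2
  have m3 := (hasDerivAt_pow 3 t).mul (h2.pow 2)
  refine ((((m1.const_mul (5 / 8)).sub (m2.const_mul (1 / 4))).sub (m3.const_mul (1 / 4))).sub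
    ((hasDerivAt_primitive_one t).const_mul (A / 2 + B / 4))).congr_deriv ?_
  have hr := besselE_recurrence 1 t
  norm_num at hr ⊢
  rw [hr]
  ring

lemma hasDerivAt_primitive_three (A B t : ℝ) : HasDerivAt
    (fun t => (9 / 16 - 5 / 8 * A - 1 / 2 * B) * (t ^ 2 * besselE 1 t ^ 2)
      + (-1 / 8 + 1 / 4 * A + 1 / 2 * B) * (t ^ 2 * besselE 1 t * besselE 2 t)
      + (-1 / 8 + 1 / 4 * A + 1 / 4 * B) * (t ^ 3 * besselE 2 t ^ 2)
      - 5 / 24 * (t ^ 3 * besselE 1 t ^ 2) + 5 / 8 * (t ^ 3 * besselE 1 t * besselE 2 t)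
      + 5 / 24 * (t ^ 4 * besselE 2 t ^ 2) - 1 / 8 * B ^ 2 * (t ^ 2 * besselE 2 t ^ 2)
      + (A ^ 2 / 4 + A * B / 4 + B ^ 2 / 8) * (t ^ 2 * besselE 1 t ^ 2
        - t ^ 2 * besselE 1 t * besselE 2 t - t ^ 3 * besselE 2 t ^ 2))
    (t * ((1 - A / 2) * besselE 1 t - B / 2 * besselE 2 t + B / 2 * t * besselE 3 t) ^ 2
      + 3 / 4 * t ^ 2 * (2 * ((1 - A / 2) * besselE 1 t - B / 2 * besselE 2 t
        + B / 2 * t * besselE 3 t) * (besselE 2 t - B * besselE 3 t))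
      + 5 / 8 * t ^ 3 * (besselE 2 t - B * besselE 3 t) ^ 2) t := by
  have h1 := hasDerivAt_besselE 1 t
  have h2 := hasDerivAt_besselE 2 t
  have m1 := (hasDerivAt_pow 2 t).mul (h1.pow 2)
  have m2 := ((hasDerivAt_pow 2 t).mul h1).mul h2
  have m3 := (hasDerivAt_pow 3 t).mul (h2.pow 2)
  have m4 := (hasDerivAt_pow 3 t).mul (h1.pow 2)
  have m5 := ((hasDerivAt_pow 3 t).mul h1).mul h2
  have m6 := (hasDerivAt_pow 4 t).mul (h2.pow 2)
  have m7 := (hasDerivAt_pow 2 t).mul (h2.pow 2)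
  refine ((((((((m1.const_mul (9 / 16 - 5 / 8 * A - 1 / 2 * B)).add
    (m2.const_mul (-1 / 8 + 1 / 4 * A + 1 / 2 * B))).add
    (m3.const_mul (-1 / 8 + 1 / 4 * A + 1 / 4 * B))).sub (m4.const_mul (5 / 24))).add
    (m5.const_mul (5 / 8))).add (m6.const_mul (5 / 24))).sub
    (m7.const_mul (1 / 8 * B ^ 2))).add ((hasDerivAt_primitive_one t).const_mul
    (A ^ 2 / 4 + A * B / 4 + B ^ 2 / 8))).congr_deriv ?_
  have hr := besselE_recurrence 1 t
  norm_num at hr ⊢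
  rw [hr]
  ring

/-- The means of the first four coefficients, in terms of `E₁` and `E₂` at `T = s² b² / 4`. -/
lemma IsLocalExpansion.mean_formulas {b s κ T I a e A B : ℝ} (hb : 0 < b) (hs : 0 < s)
    (hκ : s ^ 2 = 4 * κ) (hT : T = κ * b ^ 2) (hI : I = besselE 0 T) (ha : a = besselE 1 T)
    (he : e = besselE 2 T) (hA : A = T * a / I) (hB : B = a / e) {h : ℕ → H10 (disk b)}
    (hh : IsLocalExpansion b s h) :
    (mean (disk b) ((h 0).1 0)).re = 1 / s ^ 2 * (1 - a / I) ∧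
    (mean (disk b) ((h 1).1 0)).re
      = (T ^ 2 * a ^ 2 - T ^ 2 * a * e - T ^ 3 * e ^ 2) / (2 * T * s ^ 2 * I ^ 2) ∧
    (mean (disk b) ((h 2).1 0)).re
      = (5 / 8 * (T ^ 2 * a ^ 2) - 1 / 4 * (T ^ 2 * a * e) - 1 / 4 * (T ^ 3 * e ^ 2)
        - (A / 2 + B / 4) * (T ^ 2 * a ^ 2 - T ^ 2 * a * e - T ^ 3 * e ^ 2))
        / (2 * T * s ^ 2 * I ^ 2) ∧
    (mean (disk b) ((h 3).1 0)).re
      = ((9 / 16 - 5 / 8 * A - 1 / 2 * B) * (T ^ 2 * a ^ 2)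
        + (-1 / 8 + 1 / 4 * A + 1 / 2 * B) * (T ^ 2 * a * e)
        + (-1 / 8 + 1 / 4 * A + 1 / 4 * B) * (T ^ 3 * e ^ 2)
        - 5 / 24 * (T ^ 3 * a ^ 2) + 5 / 8 * (T ^ 3 * a * e)
        + 5 / 24 * (T ^ 4 * e ^ 2) - 1 / 8 * B ^ 2 * (T ^ 2 * e ^ 2)
        + (A ^ 2 / 4 + A * B / 4 + B ^ 2 / 8) * (T ^ 2 * a ^ 2 - T ^ 2 * a * e - T ^ 3 * e ^ 2))
        / (2 * T * s ^ 2 * I ^ 2) := by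
  have hκ0 : 0 < κ := by nlinarith [sq_pos_of_pos hs]
  have hT0 : 0 < T := by rw [hT]; positivity
  have hI0 : I ≠ 0 := by rw [hI]; exact (besselE_pos 0 hT0.le).ne'
  have hpi := Real.pi_ne_zero
  obtain ⟨G₀, X₀, XX₀, hG₀, hX₀, w₀, hXX₀, eG₀, eX₀, eXX₀, dX₀, w₀0, w₀1, hw₀⟩ :=
    exists_first_coefficient (I := I) hb hs hκ (by rw [hI, hT])
  have h0 : h 0 = w₀ := eq_of_helmholtzForm_eq hs fun v => (hh.1 v).trans (hw₀ v).symm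
  obtain ⟨X₁, hX₁, w₁, eX₁, w₁1, hw₁⟩ := exists_second_coefficient (I := I) (A := A) (B := B)
    hb hs hκ
    (by rw [hI, hT]) (by rw [hA, ha, hT]) (by rw [hB, ha, he, hT]) hXX₀.neg (fun p => by
      rw [Pi.neg_apply, eXX₀ p]; ring)
  have h1 : h 1 = w₁ := eq_of_helmholtzForm_eq hs fun v => by
    rw [hw₁ v, toL2_neg hb hXX₀, inner_neg_right, ← inner_partial hb 1 (1, 0) (fun f w hw => hw.2.1) hX₀ hXX₀ dX₀ v, ← w₀1,
      ← h0]
    exact hh.2 0 v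
  have c1 := continuous_besselE 1
  have c2 := continuous_besselE 2
  have c3 := continuous_besselE 3
  -- Collects the area, the factor `1/(2I)²` from the two `x`-derivatives and the factor of the
  -- radial substitution. The primitives themselves vanish at `0`.
  have hden : ∀ x : ℝ, (Real.pi * b ^ 2)⁻¹ * (1 / (4 * I ^ 2) * (Real.pi / (2 * κ ^ 2) * x))
      = x / (2 * T * s ^ 2 * I ^ 2) := fun x => by
    rw [hκ, hT]
    field_simp
  refine ⟨?_, ?_, ?_, ?_⟩
  · have hint : ∫ p in disk b, G₀ p = 1 / s ^ 2 * (Real.pi * b ^ 2 * (1 - a / I)) := by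
      simp only [eG₀]
      rw [integral_const_mul, integral_sub (integrableOn_disk hb continuous_const)
        (integrableOn_disk hb (by fun_prop)), integral_const_mul, integral_disk_besselE hb κ,
        setIntegral_const, Measure.real, volume_disk_toReal hb, ha, hT, smul_eq_mul]
      ring
    have hone := inner_toL2 hb (continuous_const (y := (1 : ℝ))) hG₀
    simp only [one_mul, hint, toL2_one] at hone
    rw [mean, ← inner_one_eq (volume_disk_ne_top hb), h0, w₀0, hone, volume_disk_toReal hb,
      ← Complex.ofReal_mul, Complex.ofReal_re]
    field_simp
  · have hm : mean (disk b) ((h 1).1 0) = _ := hh.mean_eq hb 0 1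
    rw [show helmholtzForm s (h 0) (h 1) = _ from hh.2 0 (h 0), h0, w₀1, inner_toL2,
      ← Complex.ofReal_mul] at hm
    rw [hm, Complex.ofReal_re]
    have hint := integral_disk_even hb hκ0 (β₀ := fun t => besselE 1 t ^ 2) (β₁ := fun _ => 0)
      (β₂ := fun _ => 0) (by fun_prop) continuous_const continuous_const
      (fun t => (hasDerivAt_primitive_one t).congr_deriv (by ring))
    have hcongr : ∀ p : ℝ × ℝ, X₀ p * X₀ p = 1 / (4 * I ^ 2) *
        (p.1 ^ 2 * besselE 1 (κ * (p.1 ^ 2 + p.2 ^ 2)) ^ 2 + p.1 ^ 4 * (κ * 0)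
          + p.1 ^ 6 * (κ ^ 2 * 0)) := fun p => by
      rw [eX₀, planeE]
      field_simp
      ring
    simp only [hcongr]
    rw [integral_const_mul, hint, hden, ← hT, ← ha, ← he]
    ring
  · have hm : mean (disk b) ((h 2).1 0) = _ := hh.mean_eq hb 1 1
    rw [show helmholtzForm s (h 1) (h 1) = _ from hh.2 0 (h 1), h0, w₀1, h1, w₁1, inner_toL2,
      ← Complex.ofReal_mul] at hm
    rw [hm, Complex.ofReal_re]
    have hint := integral_disk_even hb hκ0 (β₀ := fun t => ((1 - A / 2) * besselE 1 t
        - B / 2 * besselE 2 t + B / 2 * t * besselE 3 t) * besselE 1 t)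
      (β₁ := fun t => (besselE 2 t - B * besselE 3 t) * besselE 1 t)
      (β₂ := fun _ => 0) (by fun_prop) (by fun_prop) continuous_const
      (fun t => (hasDerivAt_primitive_two A B t).congr_deriv (by ring))
    have hcongr : ∀ p : ℝ × ℝ, X₁ p * X₀ p = 1 / (4 * I ^ 2) *
        (p.1 ^ 2 * (((1 - A / 2) * besselE 1 (κ * (p.1 ^ 2 + p.2 ^ 2))
            - B / 2 * besselE 2 (κ * (p.1 ^ 2 + p.2 ^ 2))
            + B / 2 * (κ * (p.1 ^ 2 + p.2 ^ 2)) * besselE 3 (κ * (p.1 ^ 2 + p.2 ^ 2)))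
            * besselE 1 (κ * (p.1 ^ 2 + p.2 ^ 2)))
          + p.1 ^ 4 * (κ * ((besselE 2 (κ * (p.1 ^ 2 + p.2 ^ 2))
            - B * besselE 3 (κ * (p.1 ^ 2 + p.2 ^ 2))) * besselE 1 (κ * (p.1 ^ 2 + p.2 ^ 2))))
          + p.1 ^ 6 * (κ ^ 2 * 0)) := fun p => by
      rw [eX₁, eX₀]
      simp only [planeE]
      field_simp
      ring
    simp only [hcongr]
    rw [integral_const_mul, hint, hden, ← hT, ← ha, ← he]
    ring
  · have hm : mean (disk b) ((h 3).1 0) = _ := hh.mean_eq hb 1 2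
    rw [show helmholtzForm s (h 1) (h 2) = _ from hh.2 1 (h 1), h1, w₁1, inner_toL2,
      ← Complex.ofReal_mul] at hm
    rw [hm, Complex.ofReal_re]
    have hint := integral_disk_even hb hκ0 (β₀ := fun t => ((1 - A / 2) * besselE 1 t
        - B / 2 * besselE 2 t + B / 2 * t * besselE 3 t) ^ 2)
      (β₁ := fun t => 2 * ((1 - A / 2) * besselE 1 t
        - B / 2 * besselE 2 t + B / 2 * t * besselE 3 t) * (besselE 2 t - B * besselE 3 t))
      (β₂ := fun t => (besselE 2 t - B * besselE 3 t) ^ 2) (by fun_prop) (by fun_prop)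
      (by fun_prop) (hasDerivAt_primitive_three A B)
    have hcongr : ∀ p : ℝ × ℝ, X₁ p * X₁ p = 1 / (4 * I ^ 2) *
        (p.1 ^ 2 * ((1 - A / 2) * besselE 1 (κ * (p.1 ^ 2 + p.2 ^ 2))
            - B / 2 * besselE 2 (κ * (p.1 ^ 2 + p.2 ^ 2))
            + B / 2 * (κ * (p.1 ^ 2 + p.2 ^ 2)) * besselE 3 (κ * (p.1 ^ 2 + p.2 ^ 2))) ^ 2
          + p.1 ^ 4 * (κ * (2 * ((1 - A / 2) * besselE 1 (κ * (p.1 ^ 2 + p.2 ^ 2))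
            - B / 2 * besselE 2 (κ * (p.1 ^ 2 + p.2 ^ 2))
            + B / 2 * (κ * (p.1 ^ 2 + p.2 ^ 2)) * besselE 3 (κ * (p.1 ^ 2 + p.2 ^ 2)))
            * (besselE 2 (κ * (p.1 ^ 2 + p.2 ^ 2))
            - B * besselE 3 (κ * (p.1 ^ 2 + p.2 ^ 2)))))
          + p.1 ^ 6 * (κ ^ 2 * (besselE 2 (κ * (p.1 ^ 2 + p.2 ^ 2))
            - B * besselE 3 (κ * (p.1 ^ 2 + p.2 ^ 2))) ^ 2)) := fun p => by
      rw [eX₁]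
      simp only [planeE]
      field_simp
      ring
    simp only [hcongr]
    rw [integral_const_mul, hint, hden, ← hT, ← ha, ← he]
    ring

end HeatContent

/-! ### The main theorem -/

open HeatContent in
theorem mainTheorem7 (b s : ℝ) (hb : 0 < b) (hs : 0 < s) :
    ∃ h : ℕ → H10 (disk b),
      -- the local coefficients exist and are unique
      (IsLocalExpansion b s h ∧ ∀ h' : ℕ → H10 (disk b), IsLocalExpansion b s h' → h' = h) ∧
      -- their means over the disk are real numbers `c j`, the coefficients of the expansion
      ∃ c : ℕ → ℝ, (∀ j, mean (disk b) ((h j).1 0) = (c j : ℂ)) ∧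
        (∀ a ε : ℝ, b ≤ a → ε = Real.sqrt (1 - (b / a) ^ 2) →
          IntegrableOn (fun t => Real.exp (-s ^ 2 * t) * heatContent (ellipse a b) t) (Ioi 0) ∧
          HasSum (fun j => c j * ε ^ (2 * j)) (heatContentLaplace (ellipse a b) s)) ∧
        ∀ u I₀ I₁ I₂ : ℝ, u = s * b → I₀ = besselI 0 u → I₁ = besselI 1 u → I₂ = besselI 2 u →
          c 0 = 1 / s ^ 2 * (1 - 2 * I₁ / (u * I₀)) ∧
          c 1 = -(1 / (2 * s ^ 2)) * (1 - 2 * I₁ / (u * I₀) - I₁ ^ 2 / I₀ ^ 2) ∧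
          c 2 = 1 / (16 * s ^ 2 * u ^ 3 * I₀ ^ 3 * I₂ ^ 2) *
            (-2 * u ^ 3 * I₀ ^ 5 + 3 * u ^ 2 * (4 + u ^ 2) * I₀ ^ 4 * I₁
              - u * (24 + 11 * u ^ 2) * I₀ ^ 3 * I₁ ^ 2
              + (16 + 8 * u ^ 2 - 3 * u ^ 4) * I₀ ^ 2 * I₁ ^ 3
              + 2 * u * (2 + 5 * u ^ 2) * I₀ * I₁ ^ 4 - 8 * u ^ 2 * I₁ ^ 5) ∧
          c 3 = 1 / (192 * s ^ 2 * u ^ 3 * I₀ ^ 4 * I₂ ^ 2) *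
            (u ^ 3 * (-12 + 5 * u ^ 2) * I₀ ^ 6
              + 2 * u ^ 2 * (36 + 7 * u ^ 2) * I₀ ^ 5 * I₁
              - 2 * u * (72 + 57 * u ^ 2 + 10 * u ^ 4) * I₀ ^ 4 * I₁ ^ 2
              + 32 * (3 + 4 * u ^ 2 + u ^ 4) * I₀ ^ 3 * I₁ ^ 3
              + u * (8 + 52 * u ^ 2 + 15 * u ^ 4) * I₀ ^ 2 * I₁ ^ 4
              - 36 * u ^ 2 * (2 + u ^ 2) * I₀ * I₁ ^ 5 + 24 * u ^ 3 * I₁ ^ 6) := by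
  obtain ⟨h, hh⟩ := exists_isLocalExpansion b hs
  refine ⟨h, ⟨hh, fun h' hh' => hh.unique hs hh'⟩, fun j => (mean (disk b) ((h j).1 0)).re,
    hh.mean_real hb, fun a ε hab hε => hh.hasSum_heatContentLaplace hb hs hab hε, ?_⟩
  intro u I₀ I₁ I₂ hu h₀ h₁ h₂
  have hu0 : 0 < u := by rw [hu]; positivity
  obtain ⟨f0, f1, f2, f3⟩ := hh.mean_formulas (κ := s ^ 2 / 4) (T := u ^ 2 / 4) hb hs (by ring)
    (by rw [hu]; ring) rfl rfl rfl rfl rfl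
  have hI₀ : besselE 0 (u ^ 2 / 4) = I₀ := by rw [h₀, besselI_eq]; ring
  have ha : besselE 1 (u ^ 2 / 4) = 2 * I₁ / u := by rw [h₁, besselI_eq]; field_simp
  have he : besselE 2 (u ^ 2 / 4) = 4 * I₂ / u ^ 2 := by rw [h₂, besselI_eq]; field_simp; ring
  have hpos₀ : 0 < I₀ := hI₀ ▸ besselE_pos 0 (by positivity)
  have hpos₂ : I₂ ≠ 0 := by
    rw [h₂, besselI_eq]
    have := besselE_pos 2 (t := u ^ 2 / 4) (by positivity)
    positivity
  have hrec : I₂ = I₀ - 2 * I₁ / u := by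
    have := besselE_recurrence 0 (u ^ 2 / 4)
    norm_num at this
    rw [hI₀, ha, he] at this
    rw [this]
    field_simp
    ring
  -- Eliminating `I₁` rather than `I₂` keeps the denominators monomials in `s`, `u`, `I₀`, `I₂`, all
  -- known to be nonzero. The four formulas become polynomial identities.
  have hI₁ : I₁ = u * (I₀ - I₂) / 2 := by rw [hrec]; field_simp; ring
  rw [hI₀, ha] at f0
  rw [hI₀, ha, he] at f1 f2 f3
  have hs' := hs.ne'
  have hu' := hu0.ne'
  have hI₀' := hpos₀.ne'
  clear hrec h₀ h₁ h₂ ha he hI₀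
  subst hI₁
  refine ⟨f0.trans ?_, f1.trans ?_, f2.trans ?_, f3.trans ?_⟩ <;> field_simp <;> ring
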